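/- Let $A$ be an integral domain. An ideal $J$ of $A$ is invertible if $JF=A$ for some fractional ideal $F$ of $A$ (so $A$ itself is an invertible ideal). We say that $A$ is - a ZPUI-domain if every proper nonzero ideal of $A$ can be written as $JP_1\cdots P_n$ with $n\ge 1$, $J$ an invertible ideal of $A$ and $P_1,\dots,P_n$ pairwise comaximal prime ideals of $A$ (that is, $P_i+P_j=A$ for $i\ne j$); - an ISP-domain if every proper nonzero ideal of $A$ can be written as $JQ_1\cdots Q_n$ with $n\ge 1$, $J$ an invertible ideal of $A$ and each $Q_i$ a proper radical ideal of $A$; - a Prüfer domain if every nonzero finitely generated ideal of $A$ is invertible; a Prüfer domain is strongly discrete if it has no nonzero idempotent prime ideal, i.e. $P^2\neq P$ for every nonzero prime ideal $P$; - h-local if $A/P$ is a local ring for every nonzero prime ideal $P$ and $A/I$ has only finitely many maximal ideals for every nonzero ideal $I$; - generalized Dedekind (in the sense of Popescu) if it is a strongly discrete Prüfer domain in which every prime ideal is the radical of a finitely generated ideal. The following are equivalent. (a) $A$ is a ZPUI-domain. (b) $A$ is an h-local strongly discrete Prüfer domain. (c) $A$ is an h-local ISP-domain. (d) $A$ is a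 generalized Dedekind ISP-domain. (e) $A$ is an ISP-domain and every ideal $I$ of $A$ has only finitely many minimal prime ideals over it. -/

import Mathlib

open scoped nonZeroDivisors

/-- An (integral) ideal of a domain is invertible if it is a unit in the monoid of fractional
ideals of the field of fractions. -/
def Ideal.IsInvertibleIdeal {A : Type*} [CommRing A] [IsDomain A] (I : Ideal A) : Prop :=
  IsUnit (I : FractionalIdeal A⁰ (FractionRing A))

/-- ZPUI-domain: every proper nonzero ideal is the product of an invertible ideal and a nonempty
product of pairwise comaximal prime ideals. -/
def IsZPUIDomain (A : Type*) [CommRing A] [IsDomain A] : Prop :=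
  ∀ I : Ideal A, I ≠ ⊥ → I ≠ ⊤ →
    ∃ (J : Ideal A) (n : ℕ) (P : Fin n → Ideal A),
      J.IsInvertibleIdeal ∧ 1 ≤ n ∧ (∀ i, (P i).IsPrime) ∧
      (∀ i j, i ≠ j → P i ⊔ P j = ⊤) ∧ I = J * ∏ i, P i

/-- ISP-domain: every proper nonzero ideal is the product of an invertible ideal and a nonempty
product of proper radical ideals. -/
def IsISPDomain (A : Type*) [CommRing A] [IsDomain A] : Prop :=
  ∀ I : Ideal A, I ≠ ⊥ → I ≠ ⊤ →
    ∃ (J : Ideal A) (n : ℕ) (Q : Fin n → Ideal A),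
      J.IsInvertibleIdeal ∧ 1 ≤ n ∧ (∀ i, Q i ≠ ⊤ ∧ (Q i).IsRadical) ∧ I = J * ∏ i, Q i

/-- Prüfer domain: every nonzero finitely generated ideal is invertible. -/
def IsPruferDomain (A : Type*) [CommRing A] [IsDomain A] : Prop :=
  ∀ I : Ideal A, I ≠ ⊥ → I.FG → I.IsInvertibleIdeal

/-- A strongly discrete Prüfer domain: a Prüfer domain without nonzero idempotent prime ideals. -/
def IsStronglyDiscretePruferDomain (A : Type*) [CommRing A] [IsDomain A] : Prop :=
  IsPruferDomain A ∧ ∀ P : Ideal A, P.IsPrime → P ≠ ⊥ → P * P ≠ P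

/-- h-local domain: `A ⧸ P` is local for every nonzero prime ideal `P`, and `A ⧸ I` is semilocal
(has only finitely many maximal ideals) for every nonzero ideal `I`. -/
def IsHLocalDomain (A : Type*) [CommRing A] [IsDomain A] : Prop :=
  (∀ P : Ideal A, P.IsPrime → P ≠ ⊥ → IsLocalRing (A ⧸ P)) ∧
  ∀ I : Ideal A, I ≠ ⊥ → Finite (MaximalSpectrum (A ⧸ I))

/-- Generalized Dedekind domain (in the sense of Popescu): a strongly discrete Prüfer domain in
which every prime ideal is the radical of a finitely generated ideal. -/
def IsGeneralizedDedekindDomain (A : Type*) [CommRing A] [IsDomain A] : Prop :=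
  IsStronglyDiscretePruferDomain A ∧
  ∀ P : Ideal A, P.IsPrime → ∃ I : Ideal A, I.FG ∧ P = I.radical

/-! ### Invertible ideals and local generators -/

section Invertible

variable {A : Type*} [CommRing A] [IsDomain A]

/-! The implications run (a) ⇒ (d) ⇒ (e) ⇒ (c) ⇒ (b) ⇒ (a). The core is that a nonzero prime `P` of
an ISP-domain is principal in `A_P` (`IsISPDomain.exists_local_uniformizer`). As ISP localizes, let
`A` be local with maximal ideal `M`. A nonzero `(x)` has a radical factor that is invertible, hence
of the form `(q)`. If a prime `N ≠ M` contained `q`, a suitable localization would have maximal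
ideal `(p)` with `p` outside the extension of `N`; then `p²` divides `q`, against radicality. So `M
= (q)`. Local uniformizers make any two elements comparable in each `A_M`
(`Ideal.comparable_of_local_uniformizer`), so `A` is Prüfer, and strongly discrete.

Under (a), factoring `P²` shows that `P` is the radical of the invertible factor. Radicals of
finitely generated ideals yield finitely many minimal primes by Zorn's lemma. ISP puts each nonzero
prime in only one maximal ideal (`IsISPDomain.maximal_unique`), which with that finiteness gives
h-locality. Finally, nonzero proper ideals of a strongly discrete valuation domain are `xP`
(`Ideal.exists_eq_span_mul_prime`), and h-locality glues these local factorizations.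

Throughout, `s * z ∈ Ideal.span {g}` with `s ∉ M` encodes that `g` divides `z` in `A_M`. -/

theorem Ideal.isInvertibleIdeal_iff {J : Ideal A} :
    J.IsInvertibleIdeal ↔ ∃ (F : Ideal A) (d : A), d ≠ 0 ∧ J * F = Ideal.span {d} := by
  constructor
  · intro h
    obtain ⟨G, hG⟩ := h.exists_right_inv
    obtain ⟨a, F, ha, rfl⟩ := FractionalIdeal.exists_eq_spanSingleton_mul G
    refine ⟨F, a, ha, ?_⟩
    apply FractionalIdeal.coeIdeal_injective (K := FractionRing A)
    have ha' : algebraMap A (FractionRing A) a ≠ 0 := by simpa using ha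
    simp only [FractionalIdeal.coeIdeal_mul, FractionalIdeal.coeIdeal_span_singleton]
    calc (J : FractionalIdeal A⁰ (FractionRing A)) * F
        = FractionalIdeal.spanSingleton A⁰ (algebraMap A (FractionRing A) a) *
            (J * (FractionalIdeal.spanSingleton A⁰ (algebraMap A (FractionRing A) a)⁻¹ * F)) := by
          rw [mul_left_comm (J : FractionalIdeal A⁰ (FractionRing A)), ← mul_assoc,
            FractionalIdeal.spanSingleton_mul_spanSingleton, mul_inv_cancel₀ ha',
            FractionalIdeal.spanSingleton_one, one_mul]
      _ = _ := by rw [hG, mul_one]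
  · rintro ⟨F, d, hd, h⟩
    have hd' : algebraMap A (FractionRing A) d ≠ 0 := by simpa using hd
    have h1 := congrArg (fun I : Ideal A => (I : FractionalIdeal A⁰ (FractionRing A))) h
    simp only [FractionalIdeal.coeIdeal_mul, FractionalIdeal.coeIdeal_span_singleton] at h1
    have h2 : IsUnit (FractionalIdeal.spanSingleton A⁰ (algebraMap A (FractionRing A) d)) :=
      IsUnit.of_mul_eq_one (FractionalIdeal.spanSingleton A⁰ (algebraMap A (FractionRing A) d)⁻¹)
        (by rw [FractionalIdeal.spanSingleton_mul_spanSingleton, mul_inv_cancel₀ hd',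
            FractionalIdeal.spanSingleton_one])
    rw [← h1] at h2
    exact isUnit_of_mul_isUnit_left h2

namespace Ideal.IsInvertibleIdeal

theorem of_mul_left {J K : Ideal A} (h : (J * K).IsInvertibleIdeal) : J.IsInvertibleIdeal := by
  rw [Ideal.isInvertibleIdeal_iff] at h ⊢
  obtain ⟨F, d, hd, h⟩ := h
  exact ⟨K * F, d, hd, by rw [← mul_assoc, h]⟩

theorem ne_bot {J : Ideal A} (h : J.IsInvertibleIdeal) : J ≠ ⊥ := by
  rintro rfl
  obtain ⟨F, d, hd, h⟩ := Ideal.isInvertibleIdeal_iff.1 h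
  rw [Ideal.bot_mul, eq_comm, Ideal.span_singleton_eq_bot] at h
  exact hd h

theorem le_of_mul_le_mul {J K L : Ideal A} (h : J.IsInvertibleIdeal) (hKL : J * K ≤ J * L) :
    K ≤ L := by
  obtain ⟨F, d, hd, h⟩ := Ideal.isInvertibleIdeal_iff.1 h
  rw [← Ideal.span_singleton_mul_right_mono hd, ← h, mul_comm J, mul_assoc, mul_assoc]
  exact Ideal.mul_mono_right hKL

theorem span_singleton {d : A} (hd : d ≠ 0) : (Ideal.span {d}).IsInvertibleIdeal :=
  Ideal.isInvertibleIdeal_iff.2 ⟨⊤, d, hd, by simp⟩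

/-- An invertible ideal is locally principal. -/
theorem exists_local_generator {J : Ideal A} (h : J.IsInvertibleIdeal) (P : Ideal A)
    [P.IsPrime] : ∃ j ∈ J, ∃ s ∉ P, ∀ z ∈ J, s * z ∈ Ideal.span {j} := by
  obtain ⟨F, d, hd, h⟩ := Ideal.isInvertibleIdeal_iff.1 h
  have key : ∃ j ∈ J, ∃ f ∈ F, ∃ u ∉ P, j * f = d * u := by
    by_contra! hcon
    have : J * F ≤ Ideal.span {d} * P := by
      rw [Ideal.mul_le]
      intro j hj f hf
      have h1 : j * f ∈ Ideal.span {d} := h ▸ Ideal.mul_mem_mul hj hf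
      obtain ⟨u, hu⟩ := Ideal.mem_span_singleton.1 h1
      rw [hu]
      refine Ideal.mul_mem_mul (Ideal.mem_span_singleton_self d) ?_
      by_contra hu'
      exact hcon j hj f hf u hu' hu
    have h2 : Ideal.span {d} * ⊤ ≤ Ideal.span {d} * P := by
      rw [Ideal.mul_top]
      exact h.ge.trans this
    rw [Ideal.span_singleton_mul_right_mono hd] at h2
    exact ‹P.IsPrime›.ne_top (top_le_iff.1 h2)
  obtain ⟨j, hj, f, hf, u, hu, hjf⟩ := key
  refine ⟨j, hj, u, hu, fun z hz => ?_⟩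
  have h1 : z * f ∈ Ideal.span {d} := h ▸ Ideal.mul_mem_mul hz hf
  obtain ⟨r, hr⟩ := Ideal.mem_span_singleton.1 h1
  refine Ideal.mem_span_singleton.2 ⟨r, mul_left_cancel₀ hd ?_⟩
  linear_combination j * hr - z * hjf

theorem eq_span_singleton [IsLocalRing A] {J : Ideal A} (h : J.IsInvertibleIdeal) :
    ∃ j, j ≠ 0 ∧ J = Ideal.span {j} := by
  obtain ⟨j, hj, s, hs, hz⟩ := h.exists_local_generator (IsLocalRing.maximalIdeal A)
  have hs' : IsUnit s := by simpa using hs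
  have hJ : J = Ideal.span {j} := by
    refine le_antisymm (fun z hzJ => ?_) ((Ideal.span_singleton_le_iff_mem _).2 hj)
    exact (Ideal.unit_mul_mem_iff_mem _ hs').1 (hz z hzJ)
  refine ⟨j, ?_, hJ⟩
  rintro rfl
  exact h.ne_bot (by rw [hJ]; simp)

theorem map {B : Type*} [CommRing B] [IsDomain B] {f : A →+* B} (hf : Function.Injective f)
    {J : Ideal A} (h : J.IsInvertibleIdeal) : (J.map f).IsInvertibleIdeal := by
  obtain ⟨F, d, hd, h⟩ := Ideal.isInvertibleIdeal_iff.1 h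
  refine Ideal.isInvertibleIdeal_iff.2 ⟨F.map f, f d, (map_ne_zero_iff f hf).2 hd, ?_⟩
  rw [← Ideal.map_mul, h, Ideal.map_span, Set.image_singleton]

theorem fg {J : Ideal A} (h : J.IsInvertibleIdeal) : J.FG := by
  have h' := (FractionalIdeal.coeIdeal_fg A⁰ (IsFractionRing.injective A (FractionRing A)) J).1
  exact h' (FractionalIdeal.fg_of_isUnit _ h)

end Ideal.IsInvertibleIdeal

/-- A nonzero ideal which is uniformly principal at each maximal ideal is invertible. -/
theorem Ideal.isInvertibleIdeal_of_local_generator {I : Ideal A} (hI : I ≠ ⊥)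
    (h : ∀ M : Ideal A, M.IsMaximal → ∃ g ∈ I, ∃ s ∉ M, ∀ z ∈ I, s * z ∈ Ideal.span {g}) :
    I.IsInvertibleIdeal := by
  obtain ⟨d, hdI, hd⟩ := Submodule.exists_mem_ne_zero_of_ne_bot hI
  have hF : ∀ f, f ∈ (Ideal.span {d}).colon (I : Set A) ↔ ∀ z ∈ I, f * z ∈ Ideal.span {d} := by
    intro f
    simp [Submodule.mem_colon]
  refine Ideal.isInvertibleIdeal_iff.2 ⟨(Ideal.span {d}).colon (I : Set A), d, hd, ?_⟩
  apply le_antisymm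
  · rw [Ideal.mul_le]
    intro z hz f hf
    rw [mul_comm]
    exact (hF f).1 hf z hz
  · set T := (I * (Ideal.span {d}).colon (I : Set A)).colon ({d} : Set A) with hT
    have hTm : ∀ c, c ∈ T ↔ c * d ∈ I * (Ideal.span {d}).colon (I : Set A) := by
      intro c; simp [hT, Submodule.mem_colon]
    suffices T = ⊤ by
      have h1 := (hTm 1).1 (this ▸ Submodule.mem_top)
      rw [one_mul] at h1
      exact (Ideal.span_singleton_le_iff_mem _).2 h1
    by_contra hne
    obtain ⟨M, hM, hTM⟩ := Ideal.exists_le_maximal T hne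
    obtain ⟨g, hg, s, hs, hz⟩ := h M hM
    refine hs (hTM ((hTm s).2 ?_))
    -- Here `s * d = g * f`; since the same `s` serves every `z ∈ I`, it follows that `f * I ⊆ (d)`.
    obtain ⟨f, hf⟩ := Ideal.mem_span_singleton.1 (hz d hdI)
    rw [hf]
    refine Ideal.mul_mem_mul hg ((hF f).2 fun z hzI => ?_)
    obtain ⟨w, hw⟩ := Ideal.mem_span_singleton.1 (hz z hzI)
    have hg0 : g ≠ 0 ∨ g = 0 := ne_or_eq g 0
    rcases hg0 with hg0 | rfl
    · refine Ideal.mem_span_singleton.2 ⟨w, mul_left_cancel₀ hg0 (mul_left_cancel₀ (a := s) ?_ ?_)⟩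
      · rintro rfl; exact hs (zero_mem _)
      · linear_combination g * f * hw - g * w * hf
    · exfalso
      rw [zero_mul, mul_eq_zero] at hf
      rcases hf with rfl | rfl
      · exact hs (zero_mem _)
      · exact hd rfl

end Invertible

/-! ### Factorizations and localization of ISP-domains -/

section Factorization

variable {A : Type*} [CommRing A] [IsDomain A]

theorem IsISPDomain.exists_multiset (h : IsISPDomain A) {I : Ideal A} (h0 : I ≠ ⊥) (h1 : I ≠ ⊤) :
    ∃ (J : Ideal A) (s : Multiset (Ideal A)), J.IsInvertibleIdeal ∧ s ≠ 0 ∧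
      (∀ Q ∈ s, Q ≠ ⊤ ∧ Q.IsRadical) ∧ I = J * s.prod := by
  obtain ⟨J, n, Q, hJ, hn, hQ, hI⟩ := h I h0 h1
  refine ⟨J, Finset.univ.val.map Q, hJ, ?_, ?_, hI⟩
  · intro h
    have := congrArg Multiset.card h
    simp at this
    omega
  · intro K hK
    obtain ⟨i, -, rfl⟩ := Multiset.mem_map.1 hK
    exact hQ i

theorem IsISPDomain.of_multiset (h : ∀ I : Ideal A, I ≠ ⊥ → I ≠ ⊤ →
    ∃ (J : Ideal A) (s : Multiset (Ideal A)), J.IsInvertibleIdeal ∧ s ≠ 0 ∧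
      (∀ Q ∈ s, Q ≠ ⊤ ∧ Q.IsRadical) ∧ I = J * s.prod) : IsISPDomain A := by
  intro I h0 h1
  obtain ⟨J, s, hJ, hs, hQ, hI⟩ := h I h0 h1
  refine ⟨J, s.toList.length, s.toList.get, hJ, ?_, fun i => ?_, ?_⟩
  · rw [Multiset.length_toList]
    exact Multiset.card_pos.2 hs
  · exact hQ _ (Multiset.mem_toList.1 (List.get_mem _ _))
  · rw [hI, ← Multiset.prod_toList, ← List.prod_ofFn, List.ofFn_get]

/-- Contract, factor, extend, and discard the radical factors that become trivial. -/
theorem IsISPDomain.localization (h : IsISPDomain A) (P : Ideal A) [P.IsPrime] :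
    IsISPDomain (Localization.AtPrime P) := by
  refine IsISPDomain.of_multiset fun I h0 h1 => ?_
  let f := algebraMap A (Localization.AtPrime P)
  have hinj : Function.Injective f :=
    IsLocalization.injective _ P.primeCompl_le_nonZeroDivisors
  have hmap : (I.comap f).map f = I := IsLocalization.map_under P.primeCompl _ I
  obtain ⟨J, s, hJ, hs, hQ, hI⟩ := h.exists_multiset (I := I.comap f)
    (fun h => h0 (by rw [← hmap, h, Ideal.map_bot])) (fun h => h1 (by rw [← hmap, h, Ideal.map_top]))
  have hmp : s.prod.map f = (s.map (Ideal.map f)).prod :=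
    map_multiset_prod (Ideal.mapHom f) s
  refine ⟨J.map f, (s.map (Ideal.map f)).filter (· ≠ ⊤), hJ.map hinj, ?_, ?_, ?_⟩
  · intro hcon
    rw [Multiset.filter_eq_nil] at hcon
    have hprod : (s.map (Ideal.map f)).prod = ⊤ := by
      rw [← Ideal.one_eq_top]
      refine Multiset.prod_eq_one fun x hx => ?_
      simpa using hcon x hx
    obtain ⟨Q, hQs⟩ := Multiset.exists_mem_of_ne_zero hs
    -- If all radical factors became trivial, `J` would extend to `I`; cancelling `J` below then
    -- makes `Q` trivial already in `A`.
    have h2 : J ≤ J * Q := by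
      calc J ≤ (J.map f).comap f := Ideal.le_comap_map
        _ = I.comap f := by
          conv_rhs => rw [← hmap, hI, Ideal.map_mul, hmp, hprod, Ideal.mul_top]
        _ ≤ J * Q := by
          rw [hI]
          exact Ideal.mul_mono_right (Ideal.le_of_dvd (Multiset.dvd_prod hQs))
    have h3 := hJ.le_of_mul_le_mul (K := ⊤) (L := Q) (by rwa [Ideal.mul_top])
    exact (hQ Q hQs).1 (top_le_iff.1 h3)
  · intro K hK
    obtain ⟨hK, hKt⟩ := Multiset.mem_filter.1 hK
    obtain ⟨Q, hQs, rfl⟩ := Multiset.mem_map.1 hK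
    refine ⟨hKt, ?_⟩
    rw [← Ideal.radical_eq_iff, ← IsLocalization.map_radical P.primeCompl,
      (hQ Q hQs).2.radical]
  · have hf : ((s.map (Ideal.map f)).filter (· ≠ ⊤)).prod = (s.map (Ideal.map f)).prod := by
      conv_rhs => rw [← Multiset.filter_add_not (· ≠ ⊤) (s.map (Ideal.map f))]
      rw [Multiset.prod_add]
      conv_lhs => rw [← mul_one (Multiset.prod _)]
      congr 1
      symm
      refine Multiset.prod_eq_one fun x hx => ?_
      simpa using (Multiset.mem_filter.1 hx).2
    rw [hf, ← hmap, hI, Ideal.map_mul, hmp]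

end Factorization

/-! ### The maximal ideal of a local ISP-domain -/

section LocalISP

variable {A : Type*} [CommRing A] [IsDomain A]

open IsLocalRing

theorem Ideal.eq_maximalIdeal_of_isRadical {A : Type*} [CommRing A] [IsLocalRing A]
    {Q : Ideal A} (hQ : Q.IsRadical)
    (h : ∀ P : Ideal A, P.IsPrime → Q ≤ P → P = maximalIdeal A) (hQt : Q ≠ ⊤) :
    Q = maximalIdeal A := by
  refine le_antisymm (le_maximalIdeal hQt) ?_
  rw [← hQ.radical, Ideal.radical_eq_sInf]
  exact le_sInf fun P hP => (h P hP.2 hP.1).ge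

theorem Ideal.isUnit_of_isRadical_span_mul {p z : A} (h : (Ideal.span {p * p * z}).IsRadical)
    (h0 : p * p * z ≠ 0) : IsUnit p := by
  have h1 : p * z ∈ Ideal.span {p * p * z} := by
    refine h ⟨2, Ideal.mem_span_singleton.2 ⟨z, by ring⟩⟩
  obtain ⟨r, hr⟩ := Ideal.mem_span_singleton.1 h1
  refine IsUnit.of_mul_eq_one r (mul_left_cancel₀ (a := p * z) ?_ (by linear_combination -hr))
  intro h2
  exact h0 (by linear_combination p * h2)

/-- Two proper factors, `J` included, would put `I` inside the square of the maximal ideal, so a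
single radical factor remains. -/
theorem IsISPDomain.isRadical_of_not_le_sq [IsLocalRing A] (h : IsISPDomain A) {I : Ideal A}
    (hI : I ≤ maximalIdeal A) (hI2 : ¬ I ≤ maximalIdeal A * maximalIdeal A) : I.IsRadical := by
  obtain ⟨J, s, hJ, hs, hQ, hI'⟩ := h.exists_multiset (I := I)
    (by rintro rfl; exact hI2 bot_le)
    (by rintro rfl; exact Ideal.IsPrime.ne_top' (top_le_iff.1 hI))
  obtain ⟨Q, hQs⟩ := Multiset.exists_mem_of_ne_zero hs
  obtain ⟨t, rfl⟩ := Multiset.exists_cons_of_mem hQs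
  have h1 : I = Q * (J * t.prod) := by rw [hI', Multiset.prod_cons]; ring
  have h2 : J * t.prod = ⊤ := by
    by_contra hne
    exact hI2 (h1 ▸ Ideal.mul_mono (le_maximalIdeal (hQ Q hQs).1) (le_maximalIdeal hne))
  rw [h2, Ideal.mul_top] at h1
  exact h1 ▸ (hQ Q hQs).2

/-- Take `b ∈ M \ M²`. For `a ∈ M` the ideal `(a², b)` is radical, so `a = r a² + t b`, and `1 - r
a` is a unit. -/
theorem IsISPDomain.maximalIdeal_principal_of_ne_sq [IsLocalRing A] (h : IsISPDomain A)
    (hM : maximalIdeal A * maximalIdeal A ≠ maximalIdeal A) :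
    ∃ p, maximalIdeal A = Ideal.span {p} := by
  have hlt : ¬ maximalIdeal A ≤ maximalIdeal A * maximalIdeal A := fun h1 =>
    hM (le_antisymm Ideal.mul_le_left h1)
  obtain ⟨b, hb, hb2⟩ := SetLike.not_le_iff_exists.1 hlt
  have key : ∀ a ∈ maximalIdeal A, a ∈ Ideal.span {b} := by
    intro a ha
    have hrad : (Ideal.span {a * a, b}).IsRadical := by
      refine h.isRadical_of_not_le_sq ?_ fun h1 => hb2 (h1 (Ideal.subset_span (by simp)))
      rw [Ideal.span_le]
      rintro x (rfl | rfl)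
      · exact Ideal.mul_mem_left _ _ ha
      · exact hb
    have h1 : a ∈ Ideal.span {a * a, b} := hrad ⟨2, by
      rw [pow_two]; exact Ideal.subset_span (by simp)⟩
    obtain ⟨r, t, hrt⟩ := Ideal.mem_span_pair.1 h1
    have hu : IsUnit (1 - r * a) := by
      by_contra hn
      have h2 : (1 - r * a) ∈ maximalIdeal A := hn
      have h3 : (1 : A) ∈ maximalIdeal A := by
        have := add_mem h2 (Ideal.mul_mem_left _ r ha)
        rwa [sub_add_cancel] at this
      exact Ideal.IsPrime.ne_top' ((Ideal.eq_top_iff_one _).2 h3)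
    rw [← Ideal.unit_mul_mem_iff_mem _ hu]
    exact Ideal.mem_span_singleton.2 ⟨t, by linear_combination -hrt⟩
  exact ⟨b, le_antisymm key ((Ideal.span_singleton_le_iff_mem _).2 hb)⟩

/-- If `M² = M`, then `N + (b) = yM` with `y ∉ N`. Write `b = y m`; cancelling `y` modulo `N` gives
`M ⊆ N + (m)`, and idempotence gives `m ∈ N + (m²)`. Modulo the prime `N`, either `m` or some `1 - m
r` vanishes; both are impossible. -/
theorem IsISPDomain.sq_ne_of_isolated [IsLocalRing A] (h : IsISPDomain A) {N : Ideal A}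
    [N.IsPrime] {b : A} (hb : b ∈ maximalIdeal A) (hbN : b ∉ N)
    (hN : ∀ P : Ideal A, P.IsPrime → N ≤ P → b ∈ P → P = maximalIdeal A) :
    maximalIdeal A * maximalIdeal A ≠ maximalIdeal A := by
  intro hM
  have hNM : N ≤ maximalIdeal A := le_maximalIdeal ‹N.IsPrime›.ne_top
  have hIM : N ⊔ Ideal.span {b} ≤ maximalIdeal A :=
    sup_le hNM ((Ideal.span_singleton_le_iff_mem _).2 hb)
  have hbI : b ∈ N ⊔ Ideal.span {b} :=
    Ideal.mem_sup_right (Ideal.mem_span_singleton_self b)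
  obtain ⟨J, s, hJ, hs, hQ, hI⟩ := h.exists_multiset (I := N ⊔ Ideal.span {b})
    (fun h0 => hbN (by
      rw [h0, Ideal.mem_bot] at hbI
      exact hbI ▸ zero_mem _))
    (fun h1 => Ideal.IsPrime.ne_top' (top_le_iff.1 (h1 ▸ hIM)))
  have hQM : ∀ Q ∈ s, Q = maximalIdeal A := by
    intro Q hQs
    have hIQ : N ⊔ Ideal.span {b} ≤ Q := by
      rw [hI]
      exact Ideal.mul_le_right.trans (Ideal.le_of_dvd (Multiset.dvd_prod hQs))
    exact Ideal.eq_maximalIdeal_of_isRadical (hQ Q hQs).2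
      (fun P hP hQP => hN P hP (le_sup_left.trans (hIQ.trans hQP)) (hQP (hIQ hbI))) (hQ Q hQs).1
  have hprod : s.prod = maximalIdeal A := by
    rw [Multiset.eq_replicate_of_mem hQM, Multiset.prod_replicate]
    exact IsIdempotentElem.pow_eq hM (Multiset.card_pos.2 hs).ne'
  rw [hprod] at hI
  obtain ⟨y, hy0, rfl⟩ := hJ.eq_span_singleton
  have hyN : y ∉ N := fun hy => hbN <| by
    have h1 : N ⊔ Ideal.span {b} ≤ N := by
      rw [hI]
      exact Ideal.mul_le_left.trans ((Ideal.span_singleton_le_iff_mem _).2 hy)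
    exact h1 hbI
  rw [hI] at hbI
  obtain ⟨m, hm, rfl⟩ := Ideal.mem_span_singleton_mul.1 hbI
  have hMle : maximalIdeal A ≤ N ⊔ Ideal.span {m} := by
    intro z hz
    have h1 : y * z ∈ N ⊔ Ideal.span {y * m} := by
      rw [hI]
      exact Ideal.mul_mem_mul (Ideal.mem_span_singleton_self y) hz
    obtain ⟨n, hn, c, hc, hnc⟩ := Submodule.mem_sup.1 h1
    obtain ⟨r, rfl⟩ := Ideal.mem_span_singleton.1 hc
    have h2 : z - m * r ∈ N := by
      refine (‹N.IsPrime›.mem_or_mem (x := y) ?_).resolve_left hyN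
      convert hn using 1
      linear_combination -hnc
    exact Submodule.mem_sup.2 ⟨_, h2, m * r, Ideal.mem_span_singleton.2 ⟨r, rfl⟩, by ring⟩
  have hm2 : m ∈ N ⊔ Ideal.span {m * m} := by
    have h1 : maximalIdeal A * maximalIdeal A ≤ N ⊔ Ideal.span {m * m} := by
      refine (Ideal.mul_mono hMle hMle).trans ?_
      rw [Ideal.sup_mul, Ideal.mul_sup, Ideal.mul_sup, Ideal.span_singleton_mul_span_singleton]
      refine sup_le (sup_le ?_ ?_) (sup_le ?_ le_sup_right)
      · exact Ideal.mul_le_left.trans le_sup_left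
      · exact Ideal.mul_le_left.trans le_sup_left
      · exact Ideal.mul_le_right.trans le_sup_left
    exact h1 (hM.symm ▸ hm)
  obtain ⟨n, hn, c, hc, hnc⟩ := Submodule.mem_sup.1 hm2
  obtain ⟨r, rfl⟩ := Ideal.mem_span_singleton.1 hc
  have h1 : m * (1 - m * r) ∈ N := by
    convert hn using 1
    linear_combination -hnc
  rcases ‹N.IsPrime›.mem_or_mem h1 with h2 | h2
  · exact hbN (Ideal.mul_mem_left _ _ h2)
  · have h3 := add_mem (hNM h2) (Ideal.mul_mem_right r _ hm)
    rw [sub_add_cancel] at h3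
    exact Ideal.IsPrime.ne_top' ((Ideal.eq_top_iff_one _).2 h3)

/-- The maximal ideal of a local ISP-domain is principal. -/
theorem IsISPDomain.maximalIdeal_principal [IsLocalRing A] (h : IsISPDomain A)
    (hM : maximalIdeal A ≠ ⊥) : ∃ p, maximalIdeal A = Ideal.span {p} := by
  obtain ⟨x, hx, hx0⟩ := Submodule.exists_mem_ne_zero_of_ne_bot hM
  obtain ⟨J, s, hJ, hs, hQ, hI⟩ := h.exists_multiset (I := Ideal.span {x})
    (by simpa using hx0)
    (fun h1 => Ideal.IsPrime.ne_top' (top_le_iff.1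
      (h1 ▸ (Ideal.span_singleton_le_iff_mem (maximalIdeal A)).2 hx)))
  obtain ⟨Q, hQs⟩ := Multiset.exists_mem_of_ne_zero hs
  obtain ⟨t, rfl⟩ := Multiset.exists_cons_of_mem hQs
  have hQinv : Q.IsInvertibleIdeal := by
    have h1 : Ideal.span {x} = Q * (J * t.prod) := by rw [hI, Multiset.prod_cons]; ring
    exact Ideal.IsInvertibleIdeal.of_mul_left
      (h1 ▸ Ideal.IsInvertibleIdeal.span_singleton hx0)
  obtain ⟨hQt, hQr⟩ := hQ Q hQs
  obtain ⟨q, hq0, rfl⟩ := hQinv.eq_span_singleton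
  refine ⟨q, (Ideal.eq_maximalIdeal_of_isRadical hQr (fun N hN hqN => ?_) hQt).symm⟩
  by_contra hNM
  have hlt : ¬ maximalIdeal A ≤ N := fun h1 =>
    hNM (le_antisymm (le_maximalIdeal hN.ne_top) h1)
  obtain ⟨b, hb, hbN⟩ := SetLike.not_le_iff_exists.1 hlt
  -- Minimality of `N₁` over `N + (b)` supplies the isolation hypothesis of `sq_ne_of_isolated`
  -- after localizing at `N₁`.
  obtain ⟨N₁, hN₁, -⟩ := Ideal.exists_minimalPrimes_le (I := N ⊔ Ideal.span {b})
    (J := maximalIdeal A)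
    (sup_le (le_maximalIdeal hN.ne_top) ((Ideal.span_singleton_le_iff_mem _).2 hb))
  have hN₁p : N₁.IsPrime := hN₁.1.1
  have hNN₁ : N ≤ N₁ := le_sup_left.trans hN₁.1.2
  have hbN₁ : b ∈ N₁ := hN₁.1.2 (Ideal.mem_sup_right (Ideal.mem_span_singleton_self b))
  let B := Localization.AtPrime N₁
  let f := algebraMap A B
  have hinj : Function.Injective f :=
    IsLocalization.injective _ N₁.primeCompl_le_nonZeroDivisors
  have hB : IsISPDomain B := h.localization N₁
  have hN'p : (N.map f).IsPrime := Ideal.isPrime_map_of_isLocalizationAtPrime N₁ hNN₁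
  have hN'c : (N.map f).comap f = N := Ideal.under_map_of_isLocalizationAtPrime N₁ hNN₁
  have hfb : f b ∈ maximalIdeal B :=
    (IsLocalization.AtPrime.to_map_mem_maximal_iff B N₁ b).2 hbN₁
  have hfbN : f b ∉ N.map f := fun h1 => hbN (hN'c ▸ h1)
  have hsq : maximalIdeal B * maximalIdeal B ≠ maximalIdeal B := by
    refine hB.sq_ne_of_isolated hfb hfbN fun P hP hNP hbP => ?_
    apply Localization.AtPrime.eq_maximalIdeal_iff_under_eq.1
    have h1 : P.under A ≤ N₁ := by
      have := Ideal.comap_mono (f := f) (le_maximalIdeal hP.ne_top)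
      exact this.trans Localization.AtPrime.under_maximalIdeal.le
    refine le_antisymm h1 (hN₁.2 ⟨Ideal.IsPrime.under A P, sup_le ?_ ?_⟩ h1)
    · exact Ideal.map_le_iff_le_comap.1 hNP
    · exact (Ideal.span_singleton_le_iff_mem _).2 hbP
  obtain ⟨p, hp⟩ := hB.maximalIdeal_principal_of_ne_sq hsq
  have hNmax : N.map f ≤ maximalIdeal B := le_maximalIdeal hN'p.ne_top
  have hpN : p ∉ N.map f := fun h1 =>
    hfbN ((Ideal.span_singleton_le_iff_mem _).2 h1 (hp ▸ hfb))
  have hqN' : f q ∈ N.map f :=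
    Ideal.mem_map_of_mem f (hqN (Ideal.mem_span_singleton_self q))
  have hdvd : ∀ z ∈ N.map f, ∃ w ∈ N.map f, z = p * w := by
    intro z hz
    obtain ⟨w, rfl⟩ := Ideal.mem_span_singleton.1 (hp ▸ hNmax hz)
    exact ⟨w, (hN'p.mem_or_mem hz).resolve_left hpN, rfl⟩
  -- Dividing by `p` twice within the extension of `N` writes `f q` as `p² v`.
  obtain ⟨w, hw, hqw⟩ := hdvd _ hqN'
  obtain ⟨v, -, rfl⟩ := hdvd _ hw
  rw [← mul_assoc] at hqw
  have hfq : (Ideal.span {f q}).IsRadical := by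
    have h1 := IsLocalization.map_radical N₁.primeCompl B (Ideal.span {q})
    rw [hQr.radical, Ideal.map_span, Set.image_singleton] at h1
    exact Ideal.radical_eq_iff.1 h1.symm
  rw [hqw] at hfq
  have hpu := Ideal.isUnit_of_isRadical_span_mul hfq
    (by rw [← hqw]; exact (map_ne_zero_iff f hinj).2 hq0)
  have hpM : p ∈ maximalIdeal B := hp ▸ Ideal.mem_span_singleton_self p
  exact hpM hpu

theorem IsISPDomain.exists_local_uniformizer (h : IsISPDomain A) (P : Ideal A) [hP : P.IsPrime]
    (hP0 : P ≠ ⊥) : ∃ p ∈ P, p ≠ 0 ∧ ∀ z ∈ P, ∃ s ∉ P, s * z ∈ Ideal.span {p} := by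
  let B := Localization.AtPrime P
  let f := algebraMap A B
  have hinj : Function.Injective f :=
    IsLocalization.injective _ P.primeCompl_le_nonZeroDivisors
  obtain ⟨x, hx, hx0⟩ := Submodule.exists_mem_ne_zero_of_ne_bot hP0
  have hfx : f x ∈ maximalIdeal B :=
    (IsLocalization.AtPrime.to_map_mem_maximal_iff B P x).2 hx
  have hM0 : maximalIdeal B ≠ ⊥ := fun h1 => hx0 <| by
    rw [h1, Ideal.mem_bot] at hfx
    exact (map_eq_zero_iff f hinj).1 hfx
  obtain ⟨p', hp'⟩ := (h.localization P).maximalIdeal_principal hM0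
  obtain ⟨⟨p, u⟩, hpu⟩ := IsLocalization.surj P.primeCompl p'
  have hu : IsUnit (f u) := IsLocalization.map_units B u
  have hp : maximalIdeal B = Ideal.span {f p} := by
    rw [hp', ← hpu, Ideal.span_singleton_mul_right_unit hu]
  have hpP : p ∈ P := by
    rw [← IsLocalization.AtPrime.to_map_mem_maximal_iff B P p]
    exact hp ▸ Ideal.mem_span_singleton_self _
  refine ⟨p, hpP, ?_, fun z hz => ?_⟩
  · rintro rfl
    exact hM0 (by rw [hp]; simp)
  · have hfz : f z ∈ (Ideal.span {p}).map f := by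
      rw [Ideal.map_span, Set.image_singleton, ← hp]
      exact (IsLocalization.AtPrime.to_map_mem_maximal_iff B P z).2 hz
    obtain ⟨s, hs, hsz⟩ :=
      (IsLocalization.algebraMap_mem_map_algebraMap_iff P.primeCompl B _ z).1 hfz
    exact ⟨s, hs, hsz⟩

end LocalISP

/-! ### The Prüfer property, and uniqueness of the maximal ideal over a prime -/

section Prufer

variable {A : Type*} [CommRing A]

/-- In `A_P` the only prime over `C` is the maximal one, so `p` is nilpotent modulo `C`. -/
theorem Ideal.exists_mul_pow_mem_of_mem_minimalPrimes {C P : Ideal A} (hP : P ∈ C.minimalPrimes)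
    {p : A} (hp : p ∈ P) : ∃ s ∉ P, ∃ n : ℕ, s * p ^ n ∈ C := by
  have hPp : P.IsPrime := hP.1.1
  by_contra! hcon
  obtain ⟨Q, hQ, hCQ, hdis⟩ := Ideal.exists_le_prime_disjoint C
    (P.primeCompl ⊔ Submonoid.powers p) <| by
      rw [Set.disjoint_left]
      intro z hzC hz
      obtain ⟨s, hs, t, ⟨n, rfl⟩, rfl⟩ := Submonoid.mem_sup.1 hz
      exact hcon s hs n hzC
  have hQP : Q ≤ P := by
    intro z hz
    by_contra hzP
    exact Set.disjoint_left.1 hdis hz (Submonoid.mem_sup_left (show z ∈ P.primeCompl from hzP))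
  exact Set.disjoint_left.1 hdis (hP.2 ⟨hQ, hCQ⟩ hQP hp)
    (Submonoid.mem_sup_right (Submonoid.mem_powers p))

/-- In `A_P`, either `p ^ n` divides `z` or `z` is a unit times a smaller power of `p`. -/
theorem Ideal.exists_mul_mem_span_pow_or {P : Ideal A} [hP : P.IsPrime] {p : A}
    (hp : ∀ z ∈ P, ∃ s ∉ P, s * z ∈ Ideal.span {p}) (z : A) (n : ℕ) :
    (∃ t ∉ P, ∃ u, t * z = p ^ n * u) ∨ ∃ k < n, ∃ t ∉ P, ∃ u ∉ P, t * z = p ^ k * u := by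
  induction n with
  | zero => exact .inl ⟨1, hP.one_notMem, z, by simp⟩
  | succ n ih =>
    rcases ih with ⟨t, ht, u, hu⟩ | ⟨k, hk, h⟩
    · by_cases huP : u ∈ P
      · obtain ⟨s, hs, hsu⟩ := hp u huP
        obtain ⟨v, hv⟩ := Ideal.mem_span_singleton.1 hsu
        refine .inl ⟨s * t, hP.mul_notMem hs ht, v, ?_⟩
        linear_combination s * hu + p ^ n * hv
      · exact .inr ⟨n, n.lt_succ_self, t, ht, u, huP, hu⟩
    · exact .inr ⟨k, hk.trans n.lt_succ_self, h⟩

/-- The contraction to `A` of the extension of `I` to the localization at `M`. -/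
def Ideal.localContraction (M : Ideal A) [M.IsPrime] (I : Ideal A) : Ideal A :=
  (I.map (algebraMap A (Localization.AtPrime M))).comap (algebraMap A (Localization.AtPrime M))

theorem Ideal.mem_localContraction {M : Ideal A} [M.IsPrime] {I : Ideal A} {z : A} :
    z ∈ Ideal.localContraction M I ↔ ∃ s ∉ M, s * z ∈ I :=
  IsLocalization.algebraMap_mem_map_algebraMap_iff M.primeCompl _ I z

theorem Multiset.exists_mul_mem_prod {M₁ M₂ : Ideal A} [h₁ : M₁.IsPrime] [h₂ : M₂.IsPrime]
    {s : Multiset (Ideal A)} (h : ∀ Q ∈ s, ∃ b ∉ M₁, ∃ m ∉ M₂, b * m ∈ Q) :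
    ∃ b ∉ M₁, ∃ m ∉ M₂, b * m ∈ s.prod := by
  induction s using Multiset.induction_on with
  | empty => exact ⟨1, h₁.one_notMem, 1, h₂.one_notMem, by simp⟩
  | cons Q s ih =>
    obtain ⟨b, hb, m, hm, hbm⟩ := ih fun K hK => h K (Multiset.mem_cons_of_mem hK)
    obtain ⟨b', hb', m', hm', hbm'⟩ := h Q (Multiset.mem_cons_self Q s)
    refine ⟨b' * b, h₁.mul_notMem hb' hb, m' * m, h₂.mul_notMem hm' hm, ?_⟩
    rw [Multiset.prod_cons, mul_mul_mul_comm]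
    exact Ideal.mul_mem_mul hbm' hbm

/-- Finite generation is what lets one `s` serve the whole ideal, as
`Ideal.isInvertibleIdeal_of_local_generator` requires. -/
theorem Ideal.FG.exists_local_generator {M : Ideal A} [hM : M.IsPrime]
    (H : ∀ x y : A, ∃ s ∉ M, s * x ∈ Ideal.span {y} ∨ s * y ∈ Ideal.span {x})
    {I : Ideal A} (hI : I.FG) : ∃ g ∈ I, ∃ s ∉ M, ∀ z ∈ I, s * z ∈ Ideal.span {g} := by
  induction I, hI using Submodule.fg_induction with
  | singleton x =>
    exact ⟨x, Ideal.mem_span_singleton_self x, 1, hM.one_notMem, fun z hz => by rwa [one_mul]⟩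
  | sup I₁ I₂ _ _ ih₁ ih₂ =>
    obtain ⟨g₁, hg₁, s₁, hs₁, h₁⟩ := ih₁
    obtain ⟨g₂, hg₂, s₂, hs₂, h₂⟩ := ih₂
    obtain ⟨t, ht, h⟩ := H g₁ g₂
    have hst := hM.mul_notMem (hM.mul_notMem hs₁ hs₂) ht
    rcases h with h | h
    · refine ⟨g₂, Submodule.mem_sup_right hg₂, s₁ * s₂ * t, hst, fun z hz => ?_⟩
      obtain ⟨z₁, hz₁, z₂, hz₂, rfl⟩ := Submodule.mem_sup.1 hz
      obtain ⟨a, ha⟩ := Ideal.mem_span_singleton.1 (h₁ z₁ hz₁)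
      obtain ⟨b, hb⟩ := Ideal.mem_span_singleton.1 (h₂ z₂ hz₂)
      obtain ⟨c, hc⟩ := Ideal.mem_span_singleton.1 h
      exact Ideal.mem_span_singleton.2 ⟨s₂ * a * c + s₁ * t * b,
        by linear_combination s₂ * t * ha + s₁ * t * hb + s₂ * a * hc⟩
    · refine ⟨g₁, Submodule.mem_sup_left hg₁, s₁ * s₂ * t, hst, fun z hz => ?_⟩
      obtain ⟨z₁, hz₁, z₂, hz₂, rfl⟩ := Submodule.mem_sup.1 hz
      obtain ⟨a, ha⟩ := Ideal.mem_span_singleton.1 (h₁ z₁ hz₁)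
      obtain ⟨b, hb⟩ := Ideal.mem_span_singleton.1 (h₂ z₂ hz₂)
      obtain ⟨c, hc⟩ := Ideal.mem_span_singleton.1 h
      exact Ideal.mem_span_singleton.2 ⟨s₂ * t * a + s₁ * b * c,
        by linear_combination s₂ * t * ha + s₁ * t * hb + s₁ * b * hc⟩

variable [IsDomain A]

/-- In `A_P`, `c` is a unit times `p ^ k`, so comparing `r` with `p ^ k` decides which of `x`, `y`
divides the other. -/
theorem Ideal.comparable_of_mul_eq {P : Ideal A} [hP : P.IsPrime] {p : A} (hp0 : p ≠ 0)
    (hp : ∀ z ∈ P, ∃ s ∉ P, s * z ∈ Ideal.span {p}) {x y c r t u : A} {k : ℕ}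
    (hc : c * y = x * r) (ht : t ∉ P) (hu : u ∉ P) (htc : t * c = p ^ k * u) :
    ∃ s ∉ P, s * x ∈ Ideal.span {y} ∨ s * y ∈ Ideal.span {x} := by
  rcases Ideal.exists_mul_mem_span_pow_or hp r k with ⟨t', ht', v, hv⟩ | ⟨j, hj, t', ht', v, hv, h⟩
  · refine ⟨u * t', hP.mul_notMem hu ht', .inr (Ideal.mem_span_singleton.2 ⟨t * v, ?_⟩)⟩
    refine mul_left_cancel₀ (pow_ne_zero k hp0) ?_
    linear_combination -t' * y * htc + t * t' * hc + t * x * hv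
  · refine ⟨t * v, hP.mul_notMem ht hv, .inl (Ideal.mem_span_singleton.2
      ⟨p ^ (k - j) * u * t', ?_⟩)⟩
    refine mul_left_cancel₀ (pow_ne_zero j hp0) ?_
    have hpow : p ^ k = p ^ j * p ^ (k - j) := by rw [← pow_add, Nat.add_sub_cancel' hj.le]
    rw [hpow] at htc
    linear_combination t' * y * htc - t * t' * hc - t * x * h

/-- If all nonzero primes are locally principal then all local rings are valuation rings. -/
theorem Ideal.comparable_of_local_uniformizer
    (H : ∀ P : Ideal A, P.IsPrime → P ≠ ⊥ →
      ∃ p ∈ P, p ≠ 0 ∧ ∀ z ∈ P, ∃ s ∉ P, s * z ∈ Ideal.span {p})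
    (M : Ideal A) [hM : M.IsPrime] (x y : A) :
    ∃ s ∉ M, s * x ∈ Ideal.span {y} ∨ s * y ∈ Ideal.span {x} := by
  by_cases hx : x = 0
  · exact ⟨1, hM.one_notMem, .inl (by simp [hx])⟩
  have hmem : ∀ a b c : A, c ∈ (Ideal.span {a}).colon ({b} : Set A) ↔ c * b ∈ Ideal.span {a} := by
    intro a b c; simp [Submodule.mem_colon]
  by_contra! hcon
  -- Both colon ideals lie in `M`; at a minimal prime over their sum, `x` and `y` are still
  -- incomparable.
  obtain ⟨P, hPC, hPM⟩ := Ideal.exists_minimalPrimes_le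
    (I := (Ideal.span {y}).colon ({x} : Set A) ⊔ (Ideal.span {x}).colon ({y} : Set A)) (J := M) <| by
      refine sup_le (fun s hs => ?_) (fun s hs => ?_)
      · by_contra hsM
        exact (hcon s hsM).1 ((hmem _ _ _).1 hs)
      · by_contra hsM
        exact (hcon s hsM).2 ((hmem _ _ _).1 hs)
  have hP : P.IsPrime := hPC.1.1
  have hCP := hPC.1.2
  have hnot : ¬ ∃ s ∉ P, s * x ∈ Ideal.span {y} ∨ s * y ∈ Ideal.span {x} := by
    rintro ⟨s, hs, h | h⟩
    · exact hs (hCP (Ideal.mem_sup_left ((hmem _ _ _).2 h)))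
    · exact hs (hCP (Ideal.mem_sup_right ((hmem _ _ _).2 h)))
  have hxP : x ∈ P := hCP (Ideal.mem_sup_right
    ((hmem _ _ _).2 (Ideal.mul_mem_right _ _ (Ideal.mem_span_singleton_self x))))
  obtain ⟨p, hpP, hp0, hp⟩ := H P hP (fun h => hx (by simpa [h] using hxP))
  obtain ⟨s, hs, n, hsn⟩ := Ideal.exists_mul_pow_mem_of_mem_minimalPrimes hPC hpP
  obtain ⟨c₁, h₁, c₂, h₂, h12⟩ := Submodule.mem_sup.1 hsn
  obtain ⟨r₁, hr₁⟩ := Ideal.mem_span_singleton.1 ((hmem _ _ _).1 h₁)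
  obtain ⟨r₂, hr₂⟩ := Ideal.mem_span_singleton.1 ((hmem _ _ _).1 h₂)
  -- Since `c₁ + c₂ = s * p ^ n` with `s ∉ P`, they are not both divisible by `p ^ (n + 1)` in
  -- `A_P`.
  rcases Ideal.exists_mul_mem_span_pow_or hp c₁ (n + 1) with
    ⟨t₁, ht₁, u₁, hu₁⟩ | ⟨k, -, t, ht, u, hu, htc⟩
  · rcases Ideal.exists_mul_mem_span_pow_or hp c₂ (n + 1) with
      ⟨t₂, ht₂, u₂, hu₂⟩ | ⟨k, -, t, ht, u, hu, htc⟩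
    · refine hP.mul_notMem (hP.mul_notMem ht₁ ht₂) hs ?_
      have : t₁ * t₂ * s = p * (t₂ * u₁ + t₁ * u₂) := by
        refine mul_left_cancel₀ (pow_ne_zero n hp0) ?_
        linear_combination t₂ * hu₁ + t₁ * hu₂ - t₁ * t₂ * h12
      rw [this]
      exact Ideal.mul_mem_right _ _ hpP
    · exact hnot (Ideal.comparable_of_mul_eq hp0 hp hr₂ ht hu htc)
  · obtain ⟨s, hs, h⟩ := Ideal.comparable_of_mul_eq hp0 hp hr₁ ht hu htc
    exact hnot ⟨s, hs, h.symm⟩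

theorem IsPruferDomain.comparable (h : IsPruferDomain A) (M : Ideal A) [hM : M.IsPrime]
    (x y : A) : ∃ s ∉ M, s * x ∈ Ideal.span {y} ∨ s * y ∈ Ideal.span {x} := by
  by_cases hx : x = 0
  · exact ⟨1, hM.one_notMem, .inl (by simp [hx])⟩
  have hxI : x ∈ Ideal.span {x, y} := Ideal.subset_span (by simp)
  have hyI : y ∈ Ideal.span {x, y} := Ideal.subset_span (by simp)
  have hinv := h (Ideal.span {x, y}) (fun h0 => hx (by simpa [h0] using hxI))
    (Submodule.fg_span (Set.toFinite _))
  obtain ⟨j, hj, s, hs, hz⟩ := hinv.exists_local_generator M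
  obtain ⟨a, ha⟩ := Ideal.mem_span_singleton.1 (hz x hxI)
  obtain ⟨b, hb⟩ := Ideal.mem_span_singleton.1 (hz y hyI)
  obtain ⟨α, β, hαβ⟩ := Ideal.mem_span_pair.1 hj
  have hj0 : j ≠ 0 := by
    rintro rfl
    rw [zero_mul, mul_eq_zero] at ha
    rcases ha with rfl | ha
    · exact hs (zero_mem _)
    · exact hx ha
  have hsab : s = α * a + β * b := by
    refine mul_left_cancel₀ hj0 ?_
    linear_combination α * ha + β * hb - s * hαβ
  have hab : a ∉ M ∨ b ∉ M := by
    by_contra! hcon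
    exact hs (hsab ▸ add_mem (Ideal.mul_mem_left _ _ hcon.1) (Ideal.mul_mem_left _ _ hcon.2))
  rcases hab with h' | h'
  · exact ⟨a * s, hM.mul_notMem h' hs, .inr (Ideal.mem_span_singleton.2
      ⟨b * s, by linear_combination a * hb - b * ha⟩)⟩
  · exact ⟨b * s, hM.mul_notMem h' hs, .inl (Ideal.mem_span_singleton.2
      ⟨a * s, by linear_combination b * ha - a * hb⟩)⟩

theorem IsISPDomain.isPruferDomain (h : IsISPDomain A) : IsPruferDomain A := by
  intro I hI hfg
  refine Ideal.isInvertibleIdeal_of_local_generator hI fun M hM => ?_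
  exact hfg.exists_local_generator
    (Ideal.comparable_of_local_uniformizer (fun P _ hP0 => h.exists_local_uniformizer P hP0) M)

theorem Ideal.notMem_of_local_mem_sq {P : Ideal A} [hP : P.IsPrime] {p : A} (hp0 : p ≠ 0)
    (hpP : p ∈ P) (hp : ∀ z ∈ P, ∃ s ∉ P, s * z ∈ Ideal.span {p}) {t : A} (ht : t ∉ P) :
    t * p ∉ P * P := by
  have key : ∀ w ∈ P * P, ∃ s ∉ P, s * w ∈ Ideal.span {p * p} := by
    intro w hw
    refine Submodule.mul_induction_on hw (fun a ha b hb => ?_) (fun a b ha hb => ?_)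
    · obtain ⟨s, hs, hsa⟩ := hp a ha
      obtain ⟨s', hs', hsb⟩ := hp b hb
      refine ⟨s * s', hP.mul_notMem hs hs', ?_⟩
      rw [← Ideal.span_singleton_mul_span_singleton, mul_mul_mul_comm]
      exact Ideal.mul_mem_mul hsa hsb
    · obtain ⟨s, hs, hsa⟩ := ha
      obtain ⟨s', hs', hsb⟩ := hb
      refine ⟨s * s', hP.mul_notMem hs hs', ?_⟩
      have : s * s' * (a + b) = s' * (s * a) + s * (s' * b) := by ring
      rw [this]
      exact add_mem (Ideal.mul_mem_left _ _ hsa) (Ideal.mul_mem_left _ _ hsb)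
  intro hmem
  obtain ⟨s, hs, hsw⟩ := key _ hmem
  obtain ⟨r, hr⟩ := Ideal.mem_span_singleton.1 hsw
  have h1 : s * t = p * r := mul_left_cancel₀ hp0 (by linear_combination hr)
  exact hP.mul_notMem hs ht (h1 ▸ Ideal.mul_mem_right _ _ hpP)

theorem IsISPDomain.isStronglyDiscretePruferDomain (h : IsISPDomain A) :
    IsStronglyDiscretePruferDomain A := by
  refine ⟨h.isPruferDomain, fun P hP hP0 hsq => ?_⟩
  obtain ⟨p, hpP, hp0, hp⟩ := h.exists_local_uniformizer P hP0
  refine Ideal.notMem_of_local_mem_sq hp0 hpP hp hP.one_notMem ?_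
  rwa [one_mul, hsq]

/-- Some product `q k` is a unit multiple of `x` at `M`, since otherwise `x` would lie in `xM`
locally; then `q` generates `Q` there. -/
theorem Ideal.exists_local_generator_of_mul {M Q K : Ideal A} [hM : M.IsPrime] {x : A}
    (hx0 : x ≠ 0) (hx : x ∈ Q * K)
    (hz : ∀ z ∈ Q * K, ∃ s ∉ M, s * z ∈ Ideal.span {x}) :
    ∃ g ∈ Q, g ≠ 0 ∧ ∀ z ∈ Q, ∃ s ∉ M, s * z ∈ Ideal.span {g} := by
  have key : ∃ q ∈ Q, ∃ k ∈ K, ∃ s ∉ M, ∃ u ∉ M, s * (q * k) = x * u := by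
    by_contra! hcon
    have h1 : ∀ w ∈ Q * K, ∃ s ∉ M, ∃ u ∈ M, s * w = x * u := by
      intro w hw
      refine Submodule.mul_induction_on hw (fun q hq k hk => ?_) (fun a b ha hb => ?_)
      · obtain ⟨s, hs, hsz⟩ := hz _ (Ideal.mul_mem_mul hq hk)
        obtain ⟨u, hu⟩ := Ideal.mem_span_singleton.1 hsz
        refine ⟨s, hs, u, ?_, hu⟩
        by_contra huM
        exact hcon q hq k hk s hs u huM hu
      · obtain ⟨s, hs, u, hu, h⟩ := ha
        obtain ⟨s', hs', u', hu', h'⟩ := hb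
        exact ⟨s * s', hM.mul_notMem hs hs', s' * u + s * u',
          add_mem (Ideal.mul_mem_left _ _ hu) (Ideal.mul_mem_left _ _ hu'),
          by linear_combination s' * h + s * h'⟩
    obtain ⟨s, hs, u, hu, h⟩ := h1 x hx
    exact hs (mul_left_cancel₀ hx0 (by linear_combination h : x * s = x * u) ▸ hu)
  obtain ⟨q, hq, k, hk, s, hs, u, hu, h⟩ := key
  have hqk : s * (q * k) ≠ 0 := by
    rw [h]
    refine mul_ne_zero hx0 ?_
    rintro rfl
    exact hu (zero_mem _)
  refine ⟨q, hq, ?_, fun z hzQ => ?_⟩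
  · rintro rfl
    simp at hqk
  · obtain ⟨s', hs', hsz⟩ := hz _ (Ideal.mul_mem_mul hzQ hk)
    obtain ⟨r, hr⟩ := Ideal.mem_span_singleton.1 hsz
    refine ⟨s' * u, hM.mul_notMem hs' hu, Ideal.mem_span_singleton.2 ⟨s * r, ?_⟩⟩
    refine mul_left_cancel₀ hx0 ?_
    linear_combination s * q * hr - s' * z * h

/-- A radical ideal which is principal locally at a prime `M` with principal local maximal ideal
agrees locally with `M`. -/
theorem Ideal.IsRadical.exists_mul_mem {Q M : Ideal A} [hM : M.IsPrime] (hQ : Q.IsRadical)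
    (hQM : Q ≤ M) {p : A} (hpM : p ∈ M)
    (hp : ∀ z ∈ M, ∃ s ∉ M, s * z ∈ Ideal.span {p}) {g : A} (hgQ : g ∈ Q) (hg0 : g ≠ 0)
    (hg : ∀ z ∈ Q, ∃ s ∉ M, s * z ∈ Ideal.span {g}) {m : A} (hm : m ∈ M) :
    ∃ s ∉ M, s * m ∈ Q := by
  obtain ⟨t, ht, htg⟩ := hp g (hQM hgQ)
  obtain ⟨u, hu⟩ := Ideal.mem_span_singleton.1 htg
  -- If `u ∈ M`, then up to units `g = p² v`; radicality puts `p v` in `Q`, so `g` divides it and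
  -- `p` becomes a unit.
  by_cases huM : u ∈ M
  · exfalso
    obtain ⟨s, hs, hsu⟩ := hp u huM
    obtain ⟨v, hv⟩ := Ideal.mem_span_singleton.1 hsu
    have hpv : p * v ∈ Q := hQ ⟨2, by
      have : (p * v) ^ 2 = s * t * v * g := by linear_combination -s * v * hu - p * v * hv
      rw [this]
      exact Ideal.mul_mem_left _ _ hgQ⟩
    obtain ⟨s', hs', hsv⟩ := hg _ hpv
    obtain ⟨w, hw⟩ := Ideal.mem_span_singleton.1 hsv
    have h1 : s' * s * t = p * w := by
      refine mul_left_cancel₀ hg0 ?_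
      linear_combination s' * s * hu + s' * p * hv + p * hw
    exact hM.mul_notMem (hM.mul_notMem hs' hs) ht (h1 ▸ Ideal.mul_mem_right _ _ hpM)
  · obtain ⟨s, hs, hsm⟩ := hp m hm
    obtain ⟨r, hr⟩ := Ideal.mem_span_singleton.1 hsm
    refine ⟨u * s, hM.mul_notMem huM hs, ?_⟩
    have : u * s * m = r * t * g := by linear_combination u * hr - r * hu
    rw [this]
    exact Ideal.mul_mem_left _ _ hgQ

/-- In an ISP-domain every nonzero prime ideal lies in a unique maximal ideal. -/
theorem IsISPDomain.maximal_unique (h : IsISPDomain A) {P M₁ M₂ : Ideal A} (hP : P.IsPrime)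
    (hP0 : P ≠ ⊥) (hM₁ : M₁.IsMaximal) (hM₂ : M₂.IsMaximal) (hPM₁ : P ≤ M₁) (hPM₂ : P ≤ M₂) :
    M₁ = M₂ := by
  by_contra hne
  have hM₁p := hM₁.isPrime
  have hM₂p := hM₂.isPrime
  obtain ⟨x, hxP, hx0⟩ := Submodule.exists_mem_ne_zero_of_ne_bot hP0
  -- This ideal is principal at `M₁`, yet at `M₂` it is divisible by every element outside `M₁`.
  set I : Ideal A := P ⊓ Ideal.localContraction M₁ (Ideal.span {x}) with hIdef
  have hxI : x ∈ I := ⟨hxP, Ideal.le_comap_map (Ideal.mem_span_singleton_self x)⟩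
  have hIx : ∀ z ∈ I, ∃ s ∉ M₁, s * z ∈ Ideal.span {x} := fun z hz =>
    Ideal.mem_localContraction.1 hz.2
  have hIa : ∀ a ∉ M₁, ∀ z ∈ I, ∃ s ∉ M₂, ∃ w ∈ I, s * z = a * w := by
    intro a ha z hz
    have haP : a ∉ P := fun h1 => ha (hPM₁ h1)
    obtain ⟨s, hs, h1 | h1⟩ := h.isPruferDomain.comparable M₂ z a
    · obtain ⟨w, hw⟩ := Ideal.mem_span_singleton.1 h1
      refine ⟨s, hs, w, ⟨?_, ?_⟩, hw⟩
      · exact (hP.mem_or_mem (hw ▸ Ideal.mul_mem_left _ s hz.1)).resolve_left haP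
      · obtain ⟨t, ht, htz⟩ := hIx z hz
        refine Ideal.mem_localContraction.2 ⟨t * a, hM₁p.mul_notMem ht ha, ?_⟩
        have : t * a * w = s * (t * z) := by linear_combination -t * hw
        rw [this]
        exact Ideal.mul_mem_left _ _ htz
    · exfalso
      have h2 : s * a ∈ P := (Ideal.span_singleton_le_iff_mem _).2 hz.1 h1
      exact hP.mul_notMem (fun h3 => hs (hPM₂ h3)) haP h2
  obtain ⟨J, s, hJ, -, hQ, hI⟩ := h.exists_multiset (I := I)
    (fun h0 => hx0 (by simpa [h0] using hxI))
    (fun h1 => hP.ne_top (top_le_iff.1 (h1 ▸ inf_le_left)))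
  have hM₁0 : M₁ ≠ ⊥ := fun h0 => hP0 (le_bot_iff.1 (h0 ▸ hPM₁))
  obtain ⟨p, hpM, -, hp⟩ := h.exists_local_uniformizer M₁ hM₁0
  have hM₁₂ : ∃ m ∈ M₁, m ∉ M₂ := SetLike.not_le_iff_exists.1 fun hle =>
    hne (hM₁.eq_of_le hM₂.ne_top hle)
  have hM₂₁ : ∃ m ∈ M₂, m ∉ M₁ := SetLike.not_le_iff_exists.1 fun hle =>
    hne (hM₂.eq_of_le hM₁.ne_top hle).symm
  -- At `M₁` each radical factor is either trivial or equal to `M₁`, so it contains a multiple, by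
  -- some `b ∉ M₁`, of an element outside `M₂`.
  obtain ⟨b, hb, m, hm, hbm⟩ := Multiset.exists_mul_mem_prod (M₁ := M₁) (M₂ := M₂) (s := s) <| by
    intro Q hQs
    by_cases hQM : Q ≤ M₁
    · obtain ⟨t, rfl⟩ := Multiset.exists_cons_of_mem hQs
      have hIQ : I = Q * (J * t.prod) := by rw [hI, Multiset.prod_cons]; ring
      obtain ⟨g, hgQ, hg0, hg⟩ := Ideal.exists_local_generator_of_mul (M := M₁) hx0
        (hIQ ▸ hxI) (hIQ ▸ hIx)
      obtain ⟨m, hm, hm'⟩ := hM₁₂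
      obtain ⟨b, hb, hbm⟩ := (hQ Q hQs).2.exists_mul_mem hQM hpM hp hgQ hg0 hg hm
      exact ⟨b, hb, m, hm', hbm⟩
    · obtain ⟨b, hb, hb'⟩ := SetLike.not_le_iff_exists.1 hQM
      exact ⟨b, hb', 1, hM₂p.one_notMem, by rwa [mul_one]⟩
  obtain ⟨j, hj, t, ht, htJ⟩ := hJ.exists_local_generator M₂
  have hjI : j * (b * m) ∈ I := by
    rw [hI]
    exact Ideal.mul_mem_mul hj hbm
  have hIJ : I ≤ J := hI ▸ Ideal.mul_le_left
  obtain ⟨a, ha, ha'⟩ := hM₂₁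
  -- At `M₂`, `j b m` is `b a` times an element of `I ⊆ J = (j)`; cancelling `j b` forces `m ∈ M₂`.
  obtain ⟨s', hs', w, hw, hsw⟩ := hIa (b * a) (hM₁p.mul_notMem hb ha') _ hjI
  obtain ⟨r, hr⟩ := Ideal.mem_span_singleton.1 (htJ w (hIJ hw))
  have hb0 : b ≠ 0 := by
    rintro rfl
    exact hb (zero_mem _)
  have hj0 : j ≠ 0 := by
    rintro rfl
    refine hx0 ?_
    have h1 := htJ x (hIJ hxI)
    rw [Ideal.span_singleton_eq_bot.2 rfl, Ideal.mem_bot, mul_eq_zero] at h1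
    refine h1.resolve_left ?_
    rintro rfl
    exact ht (zero_mem _)
  have h1 : t * s' * m = a * r := by
    refine mul_left_cancel₀ (mul_ne_zero hj0 hb0) ?_
    linear_combination t * hsw + b * a * hr
  exact hM₂p.mul_notMem (hM₂p.mul_notMem ht hs') hm (h1 ▸ Ideal.mul_mem_right _ _ ha)

end Prufer

/-! ### Finiteness of minimal primes, h-locality, and primes of ZPUI-domains -/

section HLocal

variable {A : Type*} [CommRing A]

/-- It suffices that `I` contain a finite product of finitely generated ideals whose radicals are
minimal primes over `I`. Such products are finitely generated, so failure to contain one passes to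
unions of chains. An ideal over `I` maximal for this failure is prime, so it contains a minimal
prime `√F`, hence `F` itself: a contradiction. -/
theorem Ideal.finite_minimalPrimes_of_forall_radical_fg
    (H : ∀ P : Ideal A, P.IsPrime → ∃ F : Ideal A, F.FG ∧ P = F.radical) (I : Ideal A) :
    I.minimalPrimes.Finite := by
  classical
  let G : Ideal A → Prop := fun K => ∃ s : Multiset (Ideal A),
    (∀ F ∈ s, F.FG ∧ F.radical ∈ I.minimalPrimes) ∧ s.prod ≤ K
  by_cases hG : G I
  · obtain ⟨s, hs, hsI⟩ := hG
    refine (s.toFinset.image Ideal.radical).finite_toSet.subset fun P hP => ?_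
    have hPp : P.IsPrime := hP.1.1
    obtain ⟨F, hF, hFP⟩ := (Ideal.IsPrime.multiset_prod_le hPp).1 (hsI.trans hP.1.2)
    have h1 : F.radical ≤ P := hPp.radical_le_iff.2 hFP
    have h2 : F.radical = P := le_antisymm h1 (hP.2 (hs F hF).2.1 h1)
    simp only [Finset.coe_image, Set.mem_image, Finset.mem_coe, Multiset.mem_toFinset]
    exact ⟨F, hF, h2⟩
  · exfalso
    have hfg : ∀ s : Multiset (Ideal A), (∀ F ∈ s, F.FG) → s.prod.FG := by
      intro s hs
      induction s using Multiset.induction_on with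
      | empty => exact ⟨{1}, by simp⟩
      | cons F s ih =>
        rw [Multiset.prod_cons]
        exact (hs F (Multiset.mem_cons_self F s)).mul
          (ih fun K hK => hs K (Multiset.mem_cons_of_mem hK))
    obtain ⟨K, hIK, hK⟩ := zorn_le_nonempty₀ {K : Ideal A | ¬ G K} (fun c hc hchain K₀ hK₀ => by
      refine ⟨sSup c, ?_, fun K hK => le_sSup hK⟩
      rintro ⟨s, hs, hsc⟩
      obtain ⟨t, ht⟩ := hfg s fun F hF => (hs F hF).1
      have h1 : ∀ x ∈ t, ∃ K ∈ c, x ∈ K := fun x hx =>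
        (Submodule.mem_sSup_of_directed ⟨K₀, hK₀⟩ hchain.directedOn).1
          (hsc (ht ▸ Submodule.subset_span hx))
      obtain ⟨K, hKc, hK⟩ := DirectedOn.exists_mem_subset_of_finset_subset_biUnion
        (f := fun K : Ideal A => (K : Set A)) ⟨K₀, hK₀⟩ hchain.directedOn
        (s := t) (fun x hx => by simpa using h1 x hx)
      exact hc hKc ⟨s, hs, ht ▸ Submodule.span_le.2 hK⟩) I hG
    have hKp : K.IsPrime := by
      refine ⟨?_, fun {a b} hab => ?_⟩
      · rintro rfl
        exact hK.prop ⟨0, by simp, le_top⟩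
      · by_contra! hcon
        have hlt : ∀ a ∉ K, G (K ⊔ Ideal.span {a}) := by
          intro a ha
          by_contra hGa
          exact ha (hK.le_of_ge hGa le_sup_left
            (Ideal.mem_sup_right (Ideal.mem_span_singleton_self a)))
        obtain ⟨s, hs, hsK⟩ := hlt a hcon.1
        obtain ⟨t, ht, htK⟩ := hlt b hcon.2
        refine hK.prop ⟨s + t, fun F hF => ?_, ?_⟩
        · exact (Multiset.mem_add.1 hF).elim (hs F) (ht F)
        · rw [Multiset.prod_add]
          refine (Ideal.mul_mono hsK htK).trans ?_
          rw [Ideal.sup_mul, Ideal.mul_sup, Ideal.mul_sup, Ideal.span_singleton_mul_span_singleton]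
          exact sup_le (sup_le Ideal.mul_le_left Ideal.mul_le_left)
            (sup_le Ideal.mul_le_right ((Ideal.span_singleton_le_iff_mem _).2 hab))
    obtain ⟨P, hP, hPK⟩ := Ideal.exists_minimalPrimes_le hIK
    obtain ⟨F, hF, rfl⟩ := H P hP.1.1
    exact hK.prop ⟨{F}, by simpa using ⟨hF, hP⟩, by simpa using Ideal.le_radical.trans hPK⟩

variable [IsDomain A]

theorem IsHLocalDomain.maximal_unique (h : IsHLocalDomain A) {P M₁ M₂ : Ideal A} (hP : P.IsPrime)
    (hP0 : P ≠ ⊥) (hM₁ : M₁.IsMaximal) (hM₂ : M₂.IsMaximal) (hPM₁ : P ≤ M₁) (hPM₂ : P ≤ M₂) :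
    M₁ = M₂ := by
  have := h.1 P hP hP0
  have hmax : ∀ M : Ideal A, M.IsMaximal → P ≤ M →
      M = (IsLocalRing.maximalIdeal (A ⧸ P)).comap (Ideal.Quotient.mk P) := by
    intro M hM hPM
    have h1 : (M.map (Ideal.Quotient.mk P)).IsMaximal :=
      Ideal.IsMaximal.map_of_surjective_of_ker_le Ideal.Quotient.mk_surjective (by simpa using hPM)
    rw [← IsLocalRing.eq_maximalIdeal h1,
      Ideal.comap_map_of_surjective' _ Ideal.Quotient.mk_surjective]
    simpa using hPM
  rw [hmax M₁ hM₁ hPM₁, hmax M₂ hM₂ hPM₂]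

theorem IsHLocalDomain.finite_maximal (h : IsHLocalDomain A) {I : Ideal A} (hI : I ≠ ⊥) :
    {M : Ideal A | M.IsMaximal ∧ I ≤ M}.Finite := by
  have := h.2 I hI
  refine (Set.finite_range fun M : MaximalSpectrum (A ⧸ I) =>
    M.asIdeal.comap (Ideal.Quotient.mk I)).subset ?_
  rintro M ⟨hM, hIM⟩
  refine ⟨⟨M.map (Ideal.Quotient.mk I), ?_⟩, ?_⟩
  · exact Ideal.IsMaximal.map_of_surjective_of_ker_le Ideal.Quotient.mk_surjective
      (by simpa using hIM)
  · simp only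
    rw [Ideal.comap_map_of_surjective' _ Ideal.Quotient.mk_surjective]
    simpa using hIM

/-- A maximal ideal over `I ≠ 0` is determined by any minimal prime over `I` that it contains. -/
theorem IsHLocalDomain.of_finite_minimalPrimes
    (huniq : ∀ P M₁ M₂ : Ideal A, P.IsPrime → P ≠ ⊥ → M₁.IsMaximal → M₂.IsMaximal →
      P ≤ M₁ → P ≤ M₂ → M₁ = M₂)
    (hfin : ∀ I : Ideal A, I.minimalPrimes.Finite) : IsHLocalDomain A := by
  constructor
  · intro P hP hP0
    obtain ⟨M, hM, hPM⟩ := Ideal.exists_le_maximal P hP.ne_top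
    refine IsLocalRing.of_unique_max_ideal ⟨M.map (Ideal.Quotient.mk P), ?_, fun N hN => ?_⟩
    · exact Ideal.IsMaximal.map_of_surjective_of_ker_le Ideal.Quotient.mk_surjective
        (by simpa using hPM)
    · have h1 : (N.comap (Ideal.Quotient.mk P)).IsMaximal :=
        Ideal.comap_isMaximal_of_surjective _ Ideal.Quotient.mk_surjective
      have h2 : P ≤ N.comap (Ideal.Quotient.mk P) := by
        intro z hz
        rw [Ideal.mem_comap, Ideal.Quotient.eq_zero_iff_mem.2 hz]
        exact zero_mem _
      rw [huniq P M _ hP hP0 hM h1 hPM h2,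
        Ideal.map_comap_of_surjective _ Ideal.Quotient.mk_surjective]
  · intro I hI
    have hc : ∀ N : Ideal (A ⧸ I), I ≤ N.comap (Ideal.Quotient.mk I) := by
      intro N z hz
      rw [Ideal.mem_comap, Ideal.Quotient.eq_zero_iff_mem.2 hz]
      exact zero_mem _
    have hmin : ∀ M : MaximalSpectrum (A ⧸ I), ∃ P : I.minimalPrimes,
        P.1 ≤ M.asIdeal.comap (Ideal.Quotient.mk I) := by
      intro M
      have := M.isMaximal
      have h1 : (M.asIdeal.comap (Ideal.Quotient.mk I)).IsMaximal :=
        Ideal.comap_isMaximal_of_surjective _ Ideal.Quotient.mk_surjective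
      obtain ⟨P, hP, hPM⟩ := Ideal.exists_minimalPrimes_le (hc M.asIdeal)
      exact ⟨⟨P, hP⟩, hPM⟩
    choose F hF using hmin
    have := (hfin I).to_subtype
    refine Finite.of_injective F fun M₁ M₂ h12 => ?_
    have := M₁.isMaximal
    have := M₂.isMaximal
    have h1 := huniq (F M₁).1 _ _ (F M₁).2.1.1
      (fun h0 => hI (le_bot_iff.1 (h0 ▸ (F M₁).2.1.2)))
      (Ideal.comap_isMaximal_of_surjective _ Ideal.Quotient.mk_surjective)
      (Ideal.comap_isMaximal_of_surjective _ Ideal.Quotient.mk_surjective)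
      (hF M₁) (h12 ▸ hF M₂)
    exact MaximalSpectrum.ext (Ideal.comap_injective_of_surjective _
      Ideal.Quotient.mk_surjective h1)

theorem IsZPUIDomain.isISPDomain (h : IsZPUIDomain A) : IsISPDomain A := by
  intro I h0 h1
  obtain ⟨J, n, P, hJ, hn, hP, -, hI⟩ := h I h0 h1
  exact ⟨J, n, P, hJ, hn, fun i => ⟨(hP i).ne_top, (hP i).isRadical⟩, hI⟩

theorem IsZPUIDomain.isGeneralizedDedekindDomain (h : IsZPUIDomain A) :
    IsGeneralizedDedekindDomain A := by
  refine ⟨h.isISPDomain.isStronglyDiscretePruferDomain, fun P hP => ?_⟩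
  by_cases hP0 : P = ⊥
  · exact ⟨⊥, Submodule.fg_bot, by rw [hP0, Ideal.radical_bot_of_isReduced]⟩
  obtain ⟨J, n, Q, hJ, hn, hQ, hcom, hI⟩ := h (P * P)
    (by simpa using hP0) (fun h1 => hP.ne_top (top_le_iff.1 (h1 ▸ Ideal.mul_le_left)))
  have hPJ : P ≤ J.radical := by
    intro z hz
    refine ⟨2, ?_⟩
    have h1 : z * z ∈ J * ∏ i, Q i := hI ▸ Ideal.mul_mem_mul hz hz
    rw [pow_two]
    exact Ideal.mul_le_left h1
  refine ⟨J, hJ.fg, le_antisymm hPJ (hP.radical_le_iff.2 ?_)⟩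
  by_contra hJP
  obtain ⟨j, hj, hjP⟩ := SetLike.not_le_iff_exists.1 hJP
  have hprod : ∏ i, Q i ≤ P := by
    intro w hw
    have h1 : j * w ∈ P := Ideal.mul_le_left (hI ▸ Ideal.mul_mem_mul hj hw : j * w ∈ P * P)
    exact (hP.mem_or_mem h1).resolve_left hjP
  obtain ⟨i, -, hi⟩ := (Ideal.IsPrime.prod_le hP).1 hprod
  -- All `Q k` contain `P = Q i`, so comaximality leaves one factor: `P² = JP`. As `j ∈ J` is a unit
  -- in `A_P`, this contradicts principality of `P` there.
  have hPQ : ∀ k, P ≤ Q k := by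
    intro k
    have h1 : P * P ≤ Q k := by
      rw [hI]
      exact Ideal.mul_le_right.trans (Ideal.le_of_dvd (Finset.dvd_prod_of_mem Q (Finset.mem_univ k)))
    exact ((hQ k).mul_le.1 h1).elim id id
  have hiP : Q i = P := le_antisymm hi (hPQ i)
  have hall : ∀ k, k = i := by
    intro k
    by_contra hk
    have h1 := hcom k i hk
    rw [hiP, sup_eq_left.2 (hPQ k)] at h1
    exact (hQ k).ne_top h1
  have hprod' : ∏ i, Q i = P := by
    rw [← hiP]
    exact Finset.prod_eq_single_of_mem i (Finset.mem_univ i) fun k _ hk => absurd (hall k) hk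
  obtain ⟨p, hpP, hp0, hp⟩ := h.isISPDomain.exists_local_uniformizer P hP0
  refine Ideal.notMem_of_local_mem_sq hp0 hpP hp hjP ?_
  rw [hI, hprod']
  exact Ideal.mul_mem_mul hj hpP

end HLocal

/-! ### Ideals of strongly discrete valuation domains, and gluing -/

section StronglyDiscrete

/-- In a valuation domain without nonzero idempotent primes, every proper nonzero ideal is a
multiple of a nonzero prime. -/
theorem Ideal.exists_eq_span_mul_prime {V : Type*} [CommRing V] [IsDomain V]
    (hV : ∀ a b : V, a ∣ b ∨ b ∣ a) (hsd : ∀ P : Ideal V, P.IsPrime → P ≠ ⊥ → P * P ≠ P)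
    {K : Ideal V} (hK0 : K ≠ ⊥) (hK1 : K ≠ ⊤) :
    ∃ (x : V) (P : Ideal V), x ≠ 0 ∧ P.IsPrime ∧ P ≠ ⊥ ∧ K = Ideal.span {x} * P := by
  obtain ⟨r₀, hr₀, hr₀0⟩ := Submodule.exists_mem_ne_zero_of_ne_bot hK0
  have hle : ∀ a : V, Ideal.span {a} * K ≤ K := fun a => Ideal.mul_le_right
  -- The multipliers `a` with `aK ≠ K`: this is the prime that will occur in `K`.
  let P : Ideal V :=
    { carrier := {a | ¬ K ≤ Ideal.span {a} * K}
      zero_mem' := by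
        intro h
        rw [Ideal.span_singleton_eq_bot.2 rfl, Ideal.bot_mul] at h
        exact hK0 (le_bot_iff.1 h)
      add_mem' := by
        intro a b ha hb h
        have key : ∀ a c : V, K ≤ Ideal.span {a + a * c} * K → K ≤ Ideal.span {a} * K := by
          intro a c h
          refine h.trans (Ideal.mul_mono_left ?_)
          rw [Ideal.span_singleton_le_iff_mem, Ideal.mem_span_singleton]
          exact ⟨1 + c, by ring⟩
        rcases hV a b with ⟨c, rfl⟩ | ⟨c, rfl⟩
        · exact ha (key a c h)
        · exact hb (key b c (by rwa [add_comm]))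
      smul_mem' := by
        intro c a ha h
        refine ha (h.trans (Ideal.mul_mono_left ?_))
        rw [Ideal.span_singleton_le_iff_mem, Ideal.mem_span_singleton]
        exact ⟨c, by rw [smul_eq_mul, mul_comm]⟩ }
  have hmem : ∀ a, a ∉ P → K ≤ Ideal.span {a} * K := fun a ha => not_not.1 ha
  have hmem' : ∀ a, K ≤ Ideal.span {a} * K → a ∉ P := fun a h ha => ha h
  have hP : P.IsPrime := by
    refine ⟨?_, fun {a b} hab => ?_⟩
    · rw [Ideal.ne_top_iff_one]
      exact hmem' 1 (by rw [Ideal.span_singleton_one, Ideal.top_mul])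
    · by_contra! hcon
      refine hmem' (a * b) ?_ hab
      rw [← Ideal.span_singleton_mul_span_singleton, mul_assoc]
      exact (hmem a hcon.1).trans (Ideal.mul_mono_right (hmem b hcon.2))
  have hKP : ∀ r ∈ K, r ≠ 0 → r ∈ P := by
    intro r hr hr0
    by_contra hrP
    obtain ⟨k, hk, hrk⟩ := Ideal.mem_span_singleton_mul.1 (hmem r hrP hr)
    have : k = 1 := mul_left_cancel₀ hr0 (by rw [hrk, mul_one])
    exact hK1 ((Ideal.eq_top_iff_one _).2 (this ▸ hk))
  have hP0 : P ≠ ⊥ := fun h => hr₀0 (by simpa [h] using hKP r₀ hr₀ hr₀0)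
  have hlt : ¬ P ≤ P * P := fun h => hsd P hP hP0 (le_antisymm Ideal.mul_le_left h)
  obtain ⟨p, hp, hpP⟩ := SetLike.not_le_iff_exists.1 hlt
  have hp0 : p ≠ 0 := by
    rintro rfl
    exact hpP (zero_mem _)
  have hp' : ¬ K ≤ Ideal.span {p} * K := hp
  obtain ⟨y, hy, hyp⟩ := SetLike.not_le_iff_exists.1 hp'
  have hy0 : y ≠ 0 := by
    rintro rfl
    exact hyp (zero_mem _)
  -- Elements outside `P` divide `K` within `K`. The inclusion `⊆` uses `y ∉ pK`, and `⊇` uses `p ∉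
  -- P²`.
  have hmain : Ideal.span {p} * K = Ideal.span {y} * P := by
    apply le_antisymm
    · intro w hw
      obtain ⟨k, hk, rfl⟩ := Ideal.mem_span_singleton_mul.1 hw
      rcases hV y (p * k) with ⟨r, hr⟩ | ⟨e, he⟩
      · rw [hr]
        refine Ideal.mul_mem_mul (Ideal.mem_span_singleton_self y) ?_
        by_contra hrP
        obtain ⟨k', hk', rfl⟩ := Ideal.mem_span_singleton_mul.1 (hmem r hrP hk)
        have hr0 : r ≠ 0 := by
          rintro rfl
          exact hrP (zero_mem _)
        have h1 : y = p * k' := mul_left_cancel₀ hr0 (by linear_combination -hr)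
        exact hyp (h1 ▸ Ideal.mul_mem_mul (Ideal.mem_span_singleton_self p) hk')
      · exact absurd (he ▸ Ideal.mul_mem_right _ _ hw) hyp
    · intro w hw
      obtain ⟨r, hr, rfl⟩ := Ideal.mem_span_singleton_mul.1 hw
      rcases hV p r with ⟨t, rfl⟩ | ⟨c, hc⟩
      · rw [mul_left_comm]
        exact Ideal.mul_mem_mul (Ideal.mem_span_singleton_self p) (Ideal.mul_mem_right _ _ hy)
      · have hcP : c ∉ P := fun h => hpP (hc ▸ Ideal.mul_mem_mul hr h)
        obtain ⟨y', hy', h1⟩ := Ideal.mem_span_singleton_mul.1 (hmem c hcP hy)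
        have : y * r = p * y' := by rw [hc, ← h1]; ring
        rw [this]
        exact Ideal.mul_mem_mul (Ideal.mem_span_singleton_self p) hy'
  rcases hV p y with ⟨x, rfl⟩ | ⟨c, hc⟩
  · refine ⟨x, P, right_ne_zero_of_mul hy0, hP, hP0, ?_⟩
    rw [← Ideal.span_singleton_mul_span_singleton, mul_assoc] at hmain
    exact Ideal.span_singleton_mul_right_injective hp0 hmain
  · rw [hc, ← Ideal.span_singleton_mul_span_singleton, mul_assoc] at hmain
    have h1 : Ideal.span {c} * K = P := Ideal.span_singleton_mul_right_injective hy0 hmain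
    have hc0 : c ≠ 0 := by
      rintro rfl
      exact hp0 (by rw [hc, mul_zero])
    have hcP : c ∉ P := by
      intro h
      rw [← h1] at h
      obtain ⟨k, hk, hck⟩ := Ideal.mem_span_singleton_mul.1 h
      have : k = 1 := mul_left_cancel₀ hc0 (by rw [hck, mul_one])
      exact hK1 ((Ideal.eq_top_iff_one _).2 (this ▸ hk))
    refine ⟨1, P, one_ne_zero, hP, hP0, ?_⟩
    rw [Ideal.span_singleton_one, Ideal.top_mul]
    exact le_antisymm (h1 ▸ hmem c hcP) (h1 ▸ hle c)

variable {A : Type*} [CommRing A]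

theorem Ideal.le_of_forall_maximal {I K : Ideal A}
    (h : ∀ N : Ideal A, N.IsMaximal → ∀ z ∈ I, ∃ s ∉ N, s * z ∈ K) : I ≤ K := by
  intro z hz
  by_contra hzK
  have hmem : ∀ s, s ∈ K.colon ({z} : Set A) ↔ s * z ∈ K := by
    intro s; simp [Submodule.mem_colon]
  obtain ⟨N, hN, hle⟩ := Ideal.exists_le_maximal (K.colon ({z} : Set A)) fun h1 =>
    hzK (by simpa using (hmem 1).1 (h1 ▸ Submodule.mem_top))
  obtain ⟨s, hs, hsz⟩ := h N hN z hz
  exact hs (hle ((hmem s).2 hsz))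

theorem Ideal.localContraction_mul_le {M I K : Ideal A} [hM : M.IsPrime] :
    Ideal.localContraction M I * K ≤ Ideal.localContraction M (I * K) := by
  rw [Ideal.mul_le]
  intro a ha b hb
  obtain ⟨s, hs, hsa⟩ := Ideal.mem_localContraction.1 ha
  exact Ideal.mem_localContraction.2 ⟨s, hs, mul_assoc s a b ▸ Ideal.mul_mem_mul hsa hb⟩

variable [IsDomain A]

/-- Otherwise some prime containing `x` avoids all products `s t` with `s ∉ M`, `t ∉ N`, and so lies
in both `M` and `N`. -/
theorem IsHLocalDomain.not_localContraction_le (h : IsHLocalDomain A) {M N : Ideal A}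
    [hM : M.IsMaximal] (hN : N.IsMaximal) (hMN : M ≠ N) {x : A} (hx : x ≠ 0) :
    ¬ Ideal.localContraction M (Ideal.span {x}) ≤ N := by
  intro hle
  have hMp := hM.isPrime
  have hNp := hN.isPrime
  obtain ⟨Q, hQ, hxQ, hdis⟩ := Ideal.exists_le_prime_disjoint (Ideal.span {x})
    (M.primeCompl ⊔ N.primeCompl) <| by
      rw [Set.disjoint_left]
      intro z hzx hz
      obtain ⟨s, hs, t, ht, rfl⟩ := Submonoid.mem_sup.1 hz
      exact ht (hle (Ideal.mem_localContraction.2 ⟨s, hs, hzx⟩))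
  have hQM : Q ≤ M := by
    intro z hz
    by_contra hzM
    exact Set.disjoint_left.1 hdis hz (Submonoid.mem_sup_left (show z ∈ M.primeCompl from hzM))
  have hQN : Q ≤ N := by
    intro z hz
    by_contra hzN
    exact Set.disjoint_left.1 hdis hz (Submonoid.mem_sup_right (show z ∈ N.primeCompl from hzN))
  refine hMN (h.maximal_unique hQ (fun h0 => hx ?_) hM hN hQM hQN)
  simpa [h0] using hxQ

theorem IsHLocalDomain.exists_localContraction_eq (h : IsHLocalDomain A)
    (hA : IsStronglyDiscretePruferDomain A) {I M : Ideal A} [hM : M.IsMaximal] (hI : I ≠ ⊥)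
    (hIM : I ≤ M) : ∃ (x : A) (P : Ideal A), x ≠ 0 ∧ P.IsPrime ∧ P ≠ ⊥ ∧ P ≤ M ∧
      Ideal.localContraction M I = Ideal.localContraction M (Ideal.span {x} * P) := by
  have hMp := hM.isPrime
  let V := Localization.AtPrime M
  let f := algebraMap A V
  have hinj : Function.Injective f :=
    IsLocalization.injective _ M.primeCompl_le_nonZeroDivisors
  have hunit : ∀ s ∉ M, IsUnit (f s) := fun s hs =>
    IsLocalization.map_units V (⟨s, hs⟩ : M.primeCompl)
  have hassoc : ∀ v : V, ∃ a, Associated (f a) v := by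
    intro v
    obtain ⟨⟨a, s⟩, has⟩ := IsLocalization.surj M.primeCompl v
    refine ⟨a, ?_⟩
    rw [show f a = v * f s from has.symm]
    exact associated_mul_unit_left _ _ (IsLocalization.map_units V s)
  have hV : ∀ a b : V, a ∣ b ∨ b ∣ a := by
    intro v w
    obtain ⟨a, ha⟩ := hassoc v
    obtain ⟨b, hb⟩ := hassoc w
    rw [← ha.dvd_iff_dvd_left, ← hb.dvd_iff_dvd_right, ← ha.dvd_iff_dvd_right,
      ← hb.dvd_iff_dvd_left]
    obtain ⟨s, hs, h1 | h1⟩ := hA.1.comparable M a b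
    · right
      have := map_dvd f (Ideal.mem_span_singleton.1 h1)
      rw [map_mul] at this
      exact ((hunit s hs).dvd_mul_left).1 this
    · left
      have := map_dvd f (Ideal.mem_span_singleton.1 h1)
      rw [map_mul] at this
      exact ((hunit s hs).dvd_mul_left).1 this
  have hmap : ∀ K : Ideal V, (K.comap f).map f = K := fun K =>
    IsLocalization.map_under M.primeCompl _ K
  have hcle : ∀ K : Ideal V, K ≠ ⊤ → K.comap f ≤ M := by
    intro K hK z hz
    by_contra hzM
    exact hK (Ideal.eq_top_of_isUnit_mem _ hz (hunit z hzM))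
  have hc0 : ∀ K : Ideal V, K ≠ ⊥ → K.comap f ≠ ⊥ := by
    intro K hK h0
    exact hK (by rw [← hmap K, h0, Ideal.map_bot])
  have hsd : ∀ P : Ideal V, P.IsPrime → P ≠ ⊥ → P * P ≠ P := by
    intro P hP hP0 hPP
    have hPc : (P.comap f).IsPrime := hP.comap f
    refine hA.2 (P.comap f) hPc (hc0 P hP0) (le_antisymm Ideal.mul_le_left ?_)
    -- At a maximal ideal other than `M`, h-locality makes the contracted prime trivial, so its
    -- idempotence only has to be seen at `M`.
    refine Ideal.le_of_forall_maximal fun N hN z hz => ?_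
    by_cases hMN : M = N
    · subst hMN
      refine Ideal.mem_localContraction.1 ?_
      change f z ∈ (P.comap f * P.comap f).map f
      rw [Ideal.map_mul, hmap, hPP]
      exact hz
    · have hPN : ¬ P.comap f ≤ N := fun hle =>
        hMN (h.maximal_unique hPc (hc0 P hP0) hM hN (hcle P hP.ne_top) hle)
      obtain ⟨s, hs, hsN⟩ := SetLike.not_le_iff_exists.1 hPN
      exact ⟨s, hsN, Ideal.mul_mem_mul hs hz⟩
  have hI0 : I.map f ≠ ⊥ := by
    rwa [Ne, Ideal.map_eq_bot_iff_of_injective hinj]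
  have hI1 : I.map f ≠ ⊤ := by
    intro h1
    have h2 := Ideal.map_mono (f := f) hIM
    rw [h1, Localization.AtPrime.map_eq_maximalIdeal] at h2
    exact Ideal.IsPrime.ne_top' (top_le_iff.1 h2)
  obtain ⟨v, P, hv, hP, hP0, hIP⟩ := Ideal.exists_eq_span_mul_prime hV hsd hI0 hI1
  obtain ⟨x, hx⟩ := hassoc v
  refine ⟨x, P.comap f, ?_, hP.comap f, hc0 P hP0, hcle P hP.ne_top, ?_⟩
  · rintro rfl
    rw [map_zero] at hx
    exact hv (hx.eq_zero_iff.1 rfl)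
  · change (I.map f).comap f = ((Ideal.span {x} * P.comap f).map f).comap f
    rw [hIP, Ideal.map_mul, hmap, Ideal.map_span, Set.image_singleton,
      Ideal.span_singleton_eq_span_singleton.2 hx]

/-- A nonzero `d ∈ J` generates `J` locally outside the finitely many maximal ideals containing it;
adjoin one local generator for each of those. -/
theorem IsHLocalDomain.fg_of_local_generator (h : IsHLocalDomain A) {J : Ideal A} (hJ : J ≠ ⊥)
    (hg : ∀ N : Ideal A, N.IsMaximal → ∃ g ∈ J, ∀ z ∈ J, ∃ s ∉ N, s * z ∈ Ideal.span {g}) :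
    J.FG := by
  classical
  obtain ⟨d, hdJ, hd⟩ := Submodule.exists_mem_ne_zero_of_ne_bot hJ
  have hfin := h.finite_maximal (I := Ideal.span {d}) (by simpa using hd)
  choose! g hgJ hgz using hg
  suffices J = Ideal.span (insert d (g '' {M | M.IsMaximal ∧ Ideal.span {d} ≤ M})) by
    rw [this]
    exact Submodule.fg_span ((hfin.image g).insert d)
  apply le_antisymm
  · refine Ideal.le_of_forall_maximal fun N hN z hz => ?_
    by_cases hdN : d ∈ N
    · obtain ⟨s, hs, hsz⟩ := hgz N hN z hz
      refine ⟨s, hs, (Ideal.span_singleton_le_iff_mem _).2 (Ideal.subset_span ?_) hsz⟩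
      exact .inr ⟨N, ⟨hN, (Ideal.span_singleton_le_iff_mem _).2 hdN⟩, rfl⟩
    · exact ⟨d, hdN, Ideal.mul_mem_right _ _ (Ideal.subset_span (.inl rfl))⟩
  · rw [Ideal.span_le]
    rintro z (rfl | ⟨N, hN, rfl⟩)
    · exact hdJ
    · exact hgJ N hN.1

theorem IsHLocalDomain.isZPUIDomain (h : IsHLocalDomain A)
    (hA : IsStronglyDiscretePruferDomain A) : IsZPUIDomain A := by
  classical
  intro I hI0 hI1
  have hfin := h.finite_maximal hI0
  have hloc : ∀ M : MaximalSpectrum A, I ≤ M.asIdeal → ∃ (x : A) (P : Ideal A), x ≠ 0 ∧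
      P.IsPrime ∧ P ≠ ⊥ ∧ P ≤ M.asIdeal ∧
      Ideal.localContraction M.asIdeal I = Ideal.localContraction M.asIdeal (Ideal.span {x} * P) :=
    fun M hIM => h.exists_localContraction_eq hA hI0 hIM
  choose! x P hx hP hP0 hPM hIxP using hloc
  have hSfin : {M : MaximalSpectrum A | I ≤ M.asIdeal}.Finite := by
    refine Set.Finite.of_finite_image (f := MaximalSpectrum.asIdeal) (hfin.subset ?_) ?_
    · rintro _ ⟨M, hM, rfl⟩
      exact ⟨M.isMaximal, hM⟩
    · intro M _ N _ hMN
      exact MaximalSpectrum.ext hMN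
  set S := hSfin.toFinset with hS
  have hmemS : ∀ M, M ∈ S ↔ I ≤ M.asIdeal := fun M => by simp [hS]
  -- For `M ∈ S`, `C M` is `(x M)` at `M` and trivial at every other maximal ideal; the intersection
  -- `J` therefore has all the prescribed localizations.
  let C : MaximalSpectrum A → Ideal A := fun M =>
    Ideal.localContraction M.asIdeal (Ideal.span {x M})
  have hxC : ∀ M, x M ∈ C M := fun M => Ideal.le_comap_map (Ideal.mem_span_singleton_self _)
  have hCN : ∀ M ∈ S, ∀ N : MaximalSpectrum A, M ≠ N → ¬ C M ≤ N.asIdeal := fun M hM N hMN =>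
    h.not_localContraction_le N.isMaximal (fun h1 => hMN (MaximalSpectrum.ext h1))
      (hx M ((hmemS M).1 hM))
  have hinf : ∀ T ⊆ S, ∀ N : MaximalSpectrum A, N ∉ T → ¬ T.inf C ≤ N.asIdeal := by
    intro T hT N hN hle
    obtain ⟨M, hM, hMN⟩ := (Ideal.IsPrime.inf_le' N.isMaximal.isPrime).1 hle
    exact hCN M (hT hM) N (fun h1 => hN (h1 ▸ hM)) hMN
  have hPN : ∀ M ∈ S, ∀ N : MaximalSpectrum A, M ≠ N → ¬ P M ≤ N.asIdeal := by
    intro M hM N hMN hle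
    have hM' := (hmemS M).1 hM
    exact hMN (MaximalSpectrum.ext (h.maximal_unique (hP M hM') (hP0 M hM') M.isMaximal
      N.isMaximal (hPM M hM') hle))
  have hprod : ∀ T ⊆ S, ∀ N : MaximalSpectrum A, N ∉ T → ¬ ∏ M ∈ T, P M ≤ N.asIdeal := by
    intro T hT N hN hle
    obtain ⟨M, hM, hMN⟩ := (Ideal.IsPrime.prod_le N.isMaximal.isPrime).1 hle
    exact hPN M (hT hM) N (fun h1 => hN (h1 ▸ hM)) hMN
  set J := S.inf C with hJ
  have hJC : ∀ M ∈ S, J ≤ C M := fun M hM => Finset.inf_le hM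
  have hJx : ∀ M ∈ S, ∃ s ∉ M.asIdeal, s * x M ∈ J := by
    intro M hM
    obtain ⟨s, hs, hsM⟩ := SetLike.not_le_iff_exists.1
      (hinf (S.erase M) (Finset.erase_subset _ _) M (Finset.notMem_erase M S))
    refine ⟨s, hsM, ?_⟩
    rw [hJ, ← Finset.insert_erase hM, Finset.inf_insert]
    exact ⟨Ideal.mul_mem_left _ _ (hxC M), Ideal.mul_mem_right _ _ hs⟩
  have hJ0 : J ≠ ⊥ := by
    intro h0
    have h1 : ∏ M ∈ S, x M ∈ J := by
      rw [hJ, Submodule.mem_finsetInf]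
      intro M hM
      exact Ideal.mem_of_dvd _ (Finset.dvd_prod_of_mem x hM) (hxC M)
    rw [h0, Ideal.mem_bot, Finset.prod_eq_zero_iff] at h1
    obtain ⟨M, hM, hM0⟩ := h1
    exact hx M ((hmemS M).1 hM) hM0
  have hJfg : J.FG := by
    refine h.fg_of_local_generator hJ0 fun N hN => ?_
    by_cases hNS : ⟨N, hN⟩ ∈ S
    · obtain ⟨s, hs, hsx⟩ := hJx _ hNS
      refine ⟨_, hsx, fun z hz => ?_⟩
      obtain ⟨t, ht, htz⟩ := Ideal.mem_localContraction.1 (hJC _ hNS hz)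
      refine ⟨s * t, hN.isPrime.mul_notMem hs ht, ?_⟩
      rw [mul_assoc, ← Ideal.span_singleton_mul_span_singleton]
      exact Ideal.mul_mem_mul (Ideal.mem_span_singleton_self s) htz
    · obtain ⟨s, hs, hsN⟩ := SetLike.not_le_iff_exists.1 (hinf S subset_rfl ⟨N, hN⟩ hNS)
      exact ⟨s, hs, fun z _ => ⟨s, hsN, Ideal.mul_mem_right _ _ (Ideal.mem_span_singleton_self s)⟩⟩
  have hIeq : I = J * ∏ M ∈ S, P M := by
    apply le_antisymm
    · refine Ideal.le_of_forall_maximal fun N hN z hz => ?_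
      by_cases hNS : ⟨N, hN⟩ ∈ S
      · obtain ⟨t, ht, htz⟩ := Ideal.mem_localContraction.1
          ((hIxP _ ((hmemS _).1 hNS)).le (Ideal.le_comap_map hz))
        obtain ⟨s, hs, hsx⟩ := hJx _ hNS
        obtain ⟨e, he, heN⟩ := SetLike.not_le_iff_exists.1
          (hprod (S.erase ⟨N, hN⟩) (Finset.erase_subset _ _) ⟨N, hN⟩ (Finset.notMem_erase _ S))
        obtain ⟨w, hw, hwz⟩ := Ideal.mem_span_singleton_mul.1 htz
        refine ⟨s * t * e, hN.isPrime.mul_notMem (hN.isPrime.mul_notMem hs ht) heN, ?_⟩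
        have : s * t * e * z = s * x ⟨N, hN⟩ * (w * e) := by linear_combination -s * e * hwz
        rw [this, ← Finset.mul_prod_erase S P hNS]
        exact Ideal.mul_mem_mul hsx (Ideal.mul_mem_mul hw he)
      · have hnot : ¬ J * ∏ M ∈ S, P M ≤ N := fun hle =>
          (hN.isPrime.mul_le.1 hle).elim (hinf S subset_rfl ⟨N, hN⟩ hNS)
            (hprod S subset_rfl ⟨N, hN⟩ hNS)
        obtain ⟨s, hs, hsN⟩ := SetLike.not_le_iff_exists.1 hnot
        exact ⟨s, hsN, Ideal.mul_mem_right _ _ hs⟩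
    · refine Ideal.le_of_forall_maximal fun N hN z hz => ?_
      by_cases hNS : ⟨N, hN⟩ ∈ S
      · refine Ideal.mem_localContraction.1 ((hIxP _ ((hmemS _).1 hNS)).ge ?_)
        refine Ideal.localContraction_mul_le (Ideal.mul_mono (hJC _ hNS) ?_ hz)
        exact Ideal.le_of_dvd (Finset.dvd_prod_of_mem P hNS)
      · have hnot : ¬ I ≤ N := fun hle => hNS ((hmemS _).2 hle)
        obtain ⟨s, hs, hsN⟩ := SetLike.not_le_iff_exists.1 hnot
        exact ⟨s, hsN, Ideal.mul_mem_right _ _ hs⟩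
  refine ⟨J, S.card, fun i => P (S.equivFin.symm i), hA.1 J hJ0 hJfg, ?_, fun i => ?_,
    fun i j hij => ?_, ?_⟩
  · obtain ⟨M, hM, hIM⟩ := Ideal.exists_le_maximal I hI1
    exact Finset.card_pos.2 ⟨⟨M, hM⟩, (hmemS _).2 hIM⟩
  · exact hP _ ((hmemS _).1 (S.equivFin.symm i).2)
  -- For `M ∈ S`, `M` is the only maximal ideal containing `P M`, so distinct factors share none.
  · by_contra hne
    obtain ⟨N, hN, hle⟩ := Ideal.exists_le_maximal _ hne
    have key : ∀ i, P (S.equivFin.symm i) ≤ N →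
        (S.equivFin.symm i : MaximalSpectrum A) = ⟨N, hN⟩ := by
      intro i hi
      by_contra hiN
      exact hPN _ (S.equivFin.symm i).2 ⟨N, hN⟩ hiN hi
    refine hij (S.equivFin.symm.injective (Subtype.ext ?_))
    rw [key i (le_sup_left.trans hle), key j (le_sup_right.trans hle)]
  · rw [hIeq, ← Finset.prod_coe_sort S P]
    congr 1
    exact (Equiv.prod_comp S.equivFin.symm fun M : S => P M).symm

end StronglyDiscrete

theorem corollary2p6 (A : Type*) [CommRing A] [IsDomain A] :
    List.TFAE [
      IsZPUIDomain A,
      IsHLocalDomain A ∧ IsStronglyDiscretePruferDomain A,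
      IsHLocalDomain A ∧ IsISPDomain A,
      IsGeneralizedDedekindDomain A ∧ IsISPDomain A,
      IsISPDomain A ∧ ∀ I : Ideal A, I.minimalPrimes.Finite] := by
  tfae_have 1 → 4 := fun h => ⟨h.isGeneralizedDedekindDomain, h.isISPDomain⟩
  tfae_have 4 → 5 := fun h => ⟨h.2, Ideal.finite_minimalPrimes_of_forall_radical_fg h.1.2⟩
  tfae_have 5 → 3 := fun h => ⟨IsHLocalDomain.of_finite_minimalPrimes
    (fun _ _ _ hP hP0 h₁ h₂ => h.1.maximal_unique hP hP0 h₁ h₂) h.2, h.1⟩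
  tfae_have 3 → 2 := fun h => ⟨h.1, h.2.isStronglyDiscretePruferDomain⟩
  tfae_have 2 → 1 := fun h => h.1.isZPUIDomain h.2
  tfae_finish
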